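/- Definitions. A deterministic object type is given by a set of states, a set of operations (including their arguments) and, for each state and operation, a unique next state and a unique response; it is readable if it has an operation that never changes the state and whose response identifies the entire current state. Processes are deterministic and asynchronous and communicate by applying atomic operations to (possibly infinitely many) non-volatile shared objects whose initial states are chosen by the algorithm. Any process may individually crash at any time, any number of times; a crash resets its local state to the initial state, so that it restarts its code with the same input, and leaves the shared objects unchanged. Fix a set $V$ of possible inputs with at least two elements. An algorithm solves recoverable consensus (RC) among $n$ processes, each with an input in $V$, if in every execution (a) no two outputs differ, including outputs of different runs of the same process; (b) every output is the input of some process; (c) a process that executes its code from the beginning either crashes or produces an output after finitely many of its own steps. For a set $\mathcal T$ of types, $rcons(\mathcal T)\in\mathbb N\cup\{\infty\}$ is the maximum number of processes that can solve RC using objects of types in $\mathcal T$ together with read/write registers, or $\infty$ if there is no such maximum; $rcons(T)=rcons(\{T\})$. Theorem. Let $\mathcal T$ be a non-empty set of deterministic, readable types. If $n=\max\{rcons(T) : T\in\mathcal T\}$ exists, then $n\le rcons(\mathcal T)\le n+1$ (with $\infty+1=\infty$, if the maximum is $\infty$). If $\max\{rcons(T) : T\in\mathcal T\}$ does not exist,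 then $rcons(\mathcal T)=\infty$. -/

import Mathlib

universe u

/-- A deterministic shared object type: its sequential specification gives, for each state and each
operation (an operation includes its arguments), a unique next state and a unique response. -/
structure ObjType : Type (u + 1) where
  State : Type u
  Op : Type u
  Resp : Type u
  next : State → Op → State
  resp : State → Op → Resp

/-- A type is readable if one of its operations never changes the state and its response
identifies the entire current state. -/
def ObjType.Readable (T : ObjType.{u}) : Prop :=
  ∃ read : T.Op, (∀ q, T.next q read = q) ∧ Function.Injective fun q => T.resp q read

/-- The operations of a read/write register with contents in `α`. -/
inductive RegOp (α : Type u) : Type u where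
  | read : RegOp α
  | write (a : α) : RegOp α

/-- The read/write register with contents in `α`. A read returns the contents, a write stores its
argument and returns an acknowledgement (`none`). -/
def registerType (α : Type u) : ObjType.{u} where
  State := α
  Op := RegOp α
  Resp := Option α
  next q op := match op with
    | .read => q
    | .write a => a
  resp q op := match op with
    | .read => some q
    | .write _ => none

/-- All register types. -/
def registers : Set ObjType.{u} := Set.range registerType

/-- What a process does next, as determined by its local state: it has returned a value, or it
applies an operation to a shared object and moves to a local state that depends on the response. -/
inductive NextAction (V : Type u) {Obj : Type u} (kind : Obj → ObjType.{u}) (Loc : Type u) :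
    Type u where
  | output (v : V) : NextAction V kind Loc
  | invoke (o : Obj) (op : (kind o).Op) (k : (kind o).Resp → Loc) : NextAction V kind Loc

/-- An `n`-process algorithm with inputs and outputs in `V` using shared objects of types in `𝒯`.
There may be infinitely many objects; each starts in a state that the algorithm prescribes. -/
structure Algorithm (V : Type u) (𝒯 : Set ObjType.{u}) (n : ℕ) : Type (u + 1) where
  Obj : Type u
  kind : Obj → ObjType.{u}
  kind_mem : ∀ o, kind o ∈ 𝒯
  initShared : ∀ o, (kind o).State
  Loc : Type u
  initLocal : Fin n → V → Loc
  action : Fin n → Loc → NextAction V kind Loc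

/-- An event of an execution: a step of a process, or the crash (and restart) of a process. -/
inductive Event (n : ℕ) : Type where
  | step (p : Fin n) : Event n
  | crash (p : Fin n) : Event n

namespace Algorithm

variable {V : Type u} {𝒯 : Set ObjType.{u}} {n : ℕ}

/-- A configuration: the local states of the processes and the states of the shared objects. -/
structure Config (A : Algorithm V 𝒯 n) : Type u where
  loc : Fin n → A.Loc
  shared : ∀ o, (A.kind o).State

open Classical in
/-- The effect of an event. A step of a process performs its next operation atomically (and does
nothing if the current run of the process has already returned a value). A crash resets the local
state of one process to its initial state and leaves the shared memory unchanged. -/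
noncomputable def exec (A : Algorithm V 𝒯 n) (input : Fin n → V) (c : A.Config) :
    Event n → A.Config
  | .step p =>
    match A.action p (c.loc p) with
    | .output _ => c
    | .invoke o op k =>
      { loc := Function.update c.loc p (k ((A.kind o).resp (c.shared o) op))
        shared := Function.update c.shared o ((A.kind o).next (c.shared o) op) }
  | .crash p => { c with loc := Function.update c.loc p (A.initLocal p (input p)) }

/-- The configuration after the first `t` events of the schedule `σ`. -/
noncomputable def config (A : Algorithm V 𝒯 n) (input : Fin n → V) (σ : ℕ → Event n) :
    ℕ → A.Config
  | 0 => { loc := fun p => A.initLocal p (input p), shared := A.initShared }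
  | t + 1 => A.exec input (A.config input σ t) (σ t)

/-- After `t` events of the schedule `σ`, the current run of `p` has returned `v`. -/
def Outputs (A : Algorithm V 𝒯 n) (input : Fin n → V) (σ : ℕ → Event n) (t : ℕ) (p : Fin n)
    (v : V) : Prop :=
  A.action p ((A.config input σ t).loc p) = .output v

/-- The algorithm solves recoverable consensus when independent crashes may occur. The input of a
process stays the same in all its runs. -/
structure SolvesRC (A : Algorithm V 𝒯 n) : Prop where
  /-- No two outputs in an execution differ, including outputs in several runs of one process. -/
  agreement : ∀ (input : Fin n → V) (σ : ℕ → Event n) (s t : ℕ) (p q : Fin n) (v w : V),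
    A.Outputs input σ s p v → A.Outputs input σ t q w → v = w
  /-- Each output is the input of some process. -/
  validity : ∀ (input : Fin n → V) (σ : ℕ → Event n) (t : ℕ) (p : Fin n) (v : V),
    A.Outputs input σ t p v → ∃ q, v = input q
  /-- A process that from some time on takes infinitely many steps and never crashes produces an
  output in its last run. -/
  waitFree : ∀ (input : Fin n → V) (σ : ℕ → Event n) (p : Fin n) (t₀ : ℕ),
    (∀ t, t₀ ≤ t → σ t ≠ .crash p) → {t | σ t = .step p}.Infinite →
      ∃ t v, t₀ ≤ t ∧ A.Outputs input σ t p v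

end Algorithm

/-- `n` processes can solve recoverable consensus with inputs in `V`, with independent crashes,
using objects of the types in `𝒯` and registers. -/
def RCSolvable (V : Type u) (𝒯 : Set ObjType.{u}) (n : ℕ) : Prop :=
  ∃ A : Algorithm V (𝒯 ∪ registers) n, A.SolvesRC

/-- The (independent) recoverable consensus number of a set of types: the maximum number of
processes that can solve recoverable consensus, or `∞` if there is no maximum. -/
noncomputable def rcons (V : Type u) (𝒯 : Set ObjType.{u}) : ℕ∞ :=
  sSup {m : ℕ∞ | ∃ n : ℕ, m = n ∧ RCSolvable V 𝒯 n}

/-!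
Let an algorithm solve recoverable consensus. Allow a process a crash only while its earlier crashes
are paid for by steps of processes of smaller index; then no admissible execution stays bivalent
forever, so there is a critical configuration. There all processes are about to access the same
object, and since crashes wipe out everything but that object, its state records which of two teams
accessed it first, as long as one process is left out: its type is recording for `n - 1` processes.

Conversely, if a readable type is recording for a set of processes, two teams that each agree on a
value can agree on a common one: each team announces its value in a register, and after its access a
process reads from the object whose value has won. A tournament of such matches solves recoverable
consensus. Passing from `𝒯` to a single type thus loses at most one process.
-/

open Filter

theorem exists_frequently_eq_and_eventually_ge {α β : Type*} [LinearOrder α] [Finite α]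
    {l : Filter β} [l.NeBot] (f : β → α) : ∃ a, (∃ᶠ t in l, f t = a) ∧ ∀ᶠ t in l, a ≤ f t := by
  have hne : {a | ∃ᶠ t in l, f t = a}.Nonempty := by
    by_contra! hempty
    have hall : ∀ᶠ t in l, ∀ a, f t ≠ a :=
      eventually_all.mpr fun a => not_frequently.mp fun ha => hempty.subset ha
    obtain ⟨t, ht⟩ := hall.exists
    exact ht _ rfl
  obtain ⟨a, ha, hmin⟩ := WellFounded.has_min wellFounded_lt _ hne
  have hge : ∀ᶠ t in l, ∀ b, b < a → f t ≠ b :=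
    eventually_all.mpr fun b => eventually_imp_distrib_left.mpr fun hb =>
      not_frequently.mp fun hfreq => hmin b hfreq hb
  exact ⟨a, ha, hge.mono fun t ht => not_lt.mp fun hlt => ht _ hlt rfl⟩

theorem eventually_not_lt_of_eventually_le {α : Type*} [Preorder α] [WellFoundedLT α] {f : ℕ → α}
    (hf : ∀ᶠ t in atTop, f (t + 1) ≤ f t) : ∀ᶠ t in atTop, ¬ f (t + 1) < f t := by
  obtain ⟨t₀, ht₀⟩ := eventually_atTop.mp hf
  obtain ⟨_, ⟨t₁, ht₁, rfl⟩, hmin⟩ := WellFounded.has_min wellFounded_lt (f '' Set.Ici t₀)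
    (Set.nonempty_Ici.image f)
  have hle : ∀ t, t₁ ≤ t → f t ≤ f t₁ := fun t ht => by
    induction t, ht using Nat.le_induction with
    | base => exact le_rfl
    | succ t ht ih => exact (ht₀ t (le_trans ht₁ ht)).trans ih
  filter_upwards [eventually_ge_atTop t₁] with t ht hlt
  exact hmin _ ⟨t + 1, (le_trans ht₁ ht).trans t.le_succ, rfl⟩ (hlt.trans_le (hle t ht))

namespace Algorithm

variable {V : Type u} {𝒯 : Set ObjType.{u}} {n : ℕ} {A : Algorithm V 𝒯 n} {input input' : Fin n → V}
  {c c' : A.Config} {p q : Fin n}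

section Exec

variable {v : V} {o o' : A.Obj} {op : (A.kind o).Op} {k : (A.kind o).Resp → A.Loc}

theorem exec_step_of_output (h : A.action p (c.loc p) = .output v) :
    A.exec input c (.step p) = c := by
  simp only [exec, h]

open Classical in
theorem exec_step_of_invoke (h : A.action p (c.loc p) = .invoke o op k) :
    A.exec input c (.step p) =
      { loc := Function.update c.loc p (k ((A.kind o).resp (c.shared o) op))
        shared := Function.update c.shared o ((A.kind o).next (c.shared o) op) } := by
  simp only [exec, h]

theorem exec_step_loc_self (h : A.action p (c.loc p) = .invoke o op k) :
    (A.exec input c (.step p)).loc p = k ((A.kind o).resp (c.shared o) op) := by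
  simp [exec_step_of_invoke h]

theorem exec_step_loc_of_ne (h : q ≠ p) : (A.exec input c (.step p)).loc q = c.loc q := by
  cases hp : A.action p (c.loc p) with
  | output v => rw [exec_step_of_output hp]
  | invoke o op k => simp [exec_step_of_invoke hp, h]

theorem exec_step_shared_of_ne (h : A.action p (c.loc p) = .invoke o op k) (ho : o' ≠ o) :
    (A.exec input c (.step p)).shared o' = c.shared o' := by
  simp [exec_step_of_invoke h, ho]

theorem exec_crash_loc_self : (A.exec input c (.crash p)).loc p = A.initLocal p (input p) := by
  simp [exec]

theorem exec_crash_loc_of_ne (h : q ≠ p) : (A.exec input c (.crash p)).loc q = c.loc q := by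
  simp [exec, h]

theorem exec_crash_shared : (A.exec input c (.crash p)).shared = c.shared := rfl

theorem exec_step_comm {op' : (A.kind o').Op} {k' : (A.kind o').Resp → A.Loc} (hpq : p ≠ q)
    (ho : o ≠ o') (hp : A.action p (c.loc p) = .invoke o op k)
    (hq : A.action q (c.loc q) = .invoke o' op' k') :
    A.exec input (A.exec input c (.step p)) (.step q) =
      A.exec input (A.exec input c (.step q)) (.step p) := by
  classical
  have hq' : A.action q ((A.exec input c (.step p)).loc q) = .invoke o' op' k' := by
    rw [exec_step_loc_of_ne hpq.symm, hq]
  have hp' : A.action p ((A.exec input c (.step q)).loc p) = .invoke o op k := by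
    rw [exec_step_loc_of_ne hpq, hp]
  rw [exec_step_of_invoke hq', exec_step_of_invoke hp', exec_step_shared_of_ne hp ho.symm,
    exec_step_shared_of_ne hq ho, exec_step_of_invoke hp, exec_step_of_invoke hq]
  simp only [Function.update_comm hpq, Function.update_comm ho]

end Exec

/-- The configuration reached from `c` by a finite list of events. -/
noncomputable def execList (A : Algorithm V 𝒯 n) (input : Fin n → V) (c : A.Config)
    (l : List (Event n)) : A.Config :=
  l.foldl (A.exec input) c

@[simp] theorem execList_nil : A.execList input c [] = c := rfl

@[simp] theorem execList_cons {e : Event n} {l : List (Event n)} :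
    A.execList input c (e :: l) = A.execList input (A.exec input c e) l := rfl

@[simp] theorem execList_append {l l' : List (Event n)} :
    A.execList input c (l ++ l') = A.execList input (A.execList input c l) l' :=
  List.foldl_append

/-- The configuration in which every execution starts. -/
def initial (A : Algorithm V 𝒯 n) (input : Fin n → V) : A.Config where
  loc p := A.initLocal p (input p)
  shared := A.initShared

/-- The configurations that occur in executions. -/
def Reachable (A : Algorithm V 𝒯 n) (input : Fin n → V) (c : A.Config) : Prop :=
  ∃ l, A.execList input (A.initial input) l = c

theorem Reachable.execList (hc : A.Reachable input c) (l : List (Event n)) :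
    A.Reachable input (A.execList input c l) := by
  obtain ⟨l₀, rfl⟩ := hc
  exact ⟨l₀ ++ l, execList_append⟩

theorem config_eq_execList (σ : ℕ → Event n) (t : ℕ) :
    A.config input σ t = A.execList input (A.initial input) ((List.range t).map σ) := by
  induction t with
  | zero => rfl
  | succ t ih => simp [config, List.range_succ, ih]

theorem config_getD (l : List (Event n)) (e : Event n) (t : ℕ) :
    A.config input (fun s => l.getD s e) t =
      A.execList input (A.initial input) ((l ++ List.replicate t e).take t) := by
  rw [config_eq_execList]
  congr 1
  refine List.ext_getElem (by simp) fun s _ _ => ?_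
  by_cases hs : s < l.length
  · simp [hs]
  · simp [hs, not_lt.mp hs]

/-- In the configuration `c`, the current run of `p` has returned `v`. -/
def HasOutput (A : Algorithm V 𝒯 n) (c : A.Config) (p : Fin n) (v : V) : Prop :=
  A.action p (c.loc p) = .output v

/-- The process `p` cannot tell the two configurations apart. -/
structure Indist (A : Algorithm V 𝒯 n) (p : Fin n) (c c' : A.Config) : Prop where
  loc : c.loc p = c'.loc p
  shared : c.shared = c'.shared

theorem Indist.exec_step (h : A.Indist p c c') :
    A.Indist p (A.exec input c (.step p)) (A.exec input' c' (.step p)) := by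
  cases hp : A.action p (c.loc p) with
  | output v => rwa [exec_step_of_output hp, exec_step_of_output (h.loc ▸ hp)]
  | invoke o op k =>
    rw [exec_step_of_invoke hp, exec_step_of_invoke (h.loc ▸ hp)]
    exact ⟨by simp [h.shared], by simp [h.shared]⟩

theorem Indist.execList_replicate (h : A.Indist p c c') (k : ℕ) :
    A.Indist p (A.execList input c (List.replicate k (.step p)))
      (A.execList input' c' (List.replicate k (.step p))) := by
  induction k generalizing c c' with
  | zero => exact h
  | succ _ ih => exact ih h.exec_step

theorem indist_exec_crash (h : q ≠ p) : A.Indist q (A.exec input c (.crash p)) c :=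
  ⟨exec_crash_loc_of_ne h, exec_crash_shared⟩

theorem execList_map_step_loc_of_notMem {L : List (Fin n)} (hq : q ∉ L) :
    (A.execList input c (L.map .step)).loc q = c.loc q := by
  induction L generalizing c with
  | nil => rfl
  | cons p L ih =>
    rw [List.mem_cons, not_or] at hq
    rw [List.map_cons, execList_cons, ih hq.2, exec_step_loc_of_ne hq.1]

theorem exists_output_of_rank (rank : A.Loc → ℕ)
    (hrank : ∀ {p ℓ o op k}, A.action p ℓ = .invoke o op k → ∀ r, rank (k r) < rank ℓ)
    (σ : ℕ → Event n) (p : Fin n) (t₀ : ℕ) (hcrash : ∀ t, t₀ ≤ t → σ t ≠ .crash p)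
    (hinf : {t | σ t = .step p}.Infinite) : ∃ t v, t₀ ≤ t ∧ A.Outputs input σ t p v := by
  by_contra! hno
  have hinvoke : ∀ t, t₀ ≤ t → ∃ o op k,
      A.action p ((A.config input σ t).loc p) = .invoke o op k := fun t ht => by
    cases hact : A.action p ((A.config input σ t).loc p) with
    | output v => exact absurd hact (hno t v ht)
    | invoke o op k => exact ⟨o, op, k, rfl⟩
  have hstep : ∀ t, t₀ ≤ t → σ t = .step p →
      rank ((A.config input σ (t + 1)).loc p) < rank ((A.config input σ t).loc p) := by
    intro t ht hσ
    obtain ⟨o, op, k, hact⟩ := hinvoke t ht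
    rw [config, hσ, exec_step_loc_self hact]
    exact hrank hact _
  have hle : ∀ t, t₀ ≤ t →
      rank ((A.config input σ (t + 1)).loc p) ≤ rank ((A.config input σ t).loc p) := by
    intro t ht
    cases hσ : σ t with
    | step q =>
      rcases eq_or_ne p q with rfl | hpq
      · exact (hstep t ht hσ).le
      · rw [config, hσ, exec_step_loc_of_ne hpq]
    | crash q =>
      rw [config, hσ, exec_crash_loc_of_ne]
      rintro rfl
      exact hcrash t ht hσ
  have hstable := eventually_not_lt_of_eventually_le
    (f := fun t => rank ((A.config input σ t).loc p)) (eventually_atTop.mpr ⟨t₀, hle⟩)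
  obtain ⟨t, hσ, hlt, ht⟩ := ((Nat.frequently_atTop_iff_infinite.mpr hinf).and_eventually
    (hstable.and (eventually_ge_atTop t₀))).exists
  exact hlt (hstep t ht hσ)

namespace SolvesRC

variable {v w : V} (h : A.SolvesRC)
include h

theorem eq_of_hasOutput_execList (hc : A.Reachable input c) (hv : A.HasOutput c p v)
    {l : List (Event n)} (hw : A.HasOutput (A.execList input c l) q w) : v = w := by
  obtain ⟨l₀, rfl⟩ := hc
  refine h.agreement input (fun s => (l₀ ++ l).getD s (.step p)) l₀.length (l₀ ++ l).length
    p q v w ?_ ?_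
  · rw [Outputs, config_getD, List.append_assoc, List.take_left]
    exact hv
  · rw [Outputs, config_getD, List.take_left, execList_append]
    exact hw

theorem exists_eq_input (hc : A.Reachable input c) (hv : A.HasOutput c p v) :
    ∃ q, v = input q := by
  obtain ⟨l, rfl⟩ := hc
  refine h.validity input (fun s => l.getD s (.step p)) l.length p v ?_
  rw [Outputs, config_getD, List.take_left]
  exact hv

theorem exists_hasOutput_replicate (hc : A.Reachable input c) (p : Fin n) :
    ∃ k v, A.HasOutput (A.execList input c (List.replicate k (.step p))) p v := by
  obtain ⟨l, rfl⟩ := hc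
  have hget : ∀ t, l.length ≤ t → l.getD t (.step p) = .step p := fun t ht =>
    List.getD_eq_default _ _ ht
  obtain ⟨t, v, ht, hv⟩ := h.waitFree input (fun t => l.getD t (.step p)) p l.length
    (fun t ht => by simp only [hget t ht, ne_eq, reduceCtorEq, not_false_eq_true])
    ((Set.Ici_infinite l.length).mono hget)
  obtain ⟨k, rfl⟩ := Nat.exists_eq_add_of_le ht
  rw [Outputs, config_getD, List.take_length_add_append, List.take_replicate,
    execList_append] at hv
  exact ⟨_, v, hv⟩

end SolvesRC

end Algorithm

/-- The process that an event concerns. -/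
def Event.process {n : ℕ} : Event n → Fin n
  | .step p => p
  | .crash p => p

namespace Algorithm

variable {V : Type u} {𝒯 : Set ObjType.{u}} {n : ℕ}

section Budgets

variable {b : Fin n → ℕ} {p q : Fin n}

/-- Budgets for crashes: each step of a process pays for one crash of each process of larger
index, and a crash uses up one unit of the budget of the crashed process. -/
def recharge (b : Fin n → ℕ) : Event n → Fin n → ℕ
  | .step p, q => if p < q then b q + 1 else b q
  | .crash p, q => if q = p then b q - 1 else b q

/-- Steps are always affordable, a crash requires a positive budget. -/
def Affordable (b : Fin n → ℕ) : Event n → Prop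
  | .step _ => True
  | .crash p => 0 < b p

/-- All events of the list are affordable when they occur, starting from the budgets `b`. -/
def AffordableList (b : Fin n → ℕ) : List (Event n) → Prop
  | [] => True
  | e :: l => Affordable b e ∧ AffordableList (recharge b e) l

theorem affordableList_map_step {L : List (Fin n)} : AffordableList b (L.map .step) := by
  induction L generalizing b with
  | nil => trivial
  | cons p L ih => exact ⟨trivial, ih⟩

theorem affordableList_replicate_step {k : ℕ} :
    AffordableList b (List.replicate k (.step p)) := by
  simpa using affordableList_map_step (b := b) (L := List.replicate k p)

theorem affordableList_append {l l' : List (Event n)} :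
    AffordableList b (l ++ l') ↔ AffordableList b l ∧ AffordableList (l.foldl recharge b) l' := by
  induction l generalizing b with
  | nil => simp [AffordableList]
  | cons e l ih => simp [AffordableList, ih, and_assoc]

theorem foldl_recharge_map_step_pos {L : List (Fin n)} (h : 0 < b q ∨ ∃ p ∈ L, p < q) :
    0 < (L.map .step).foldl recharge b q := by
  induction L generalizing b with
  | nil => simpa using h
  | cons p L ih =>
    refine ih ?_
    simp only [recharge]
    split_ifs with hpq
    · exact .inl (Nat.succ_pos _)
    · simpa [hpq] using h

theorem recharge_le {e : Event n} (h : q ≤ e.process) : recharge b e q ≤ b q := by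
  cases e with
  | step p => exact (if_neg (not_lt.mpr h)).le
  | crash p => simp only [recharge]; split_ifs <;> omega

theorem recharge_crash_lt (h : Affordable b (.crash p)) : recharge b (.crash p) p < b p := by
  simp only [recharge, if_true]
  exact Nat.sub_lt h one_pos

/-- The budget of the least process that is active infinitely often is eventually constant, so
this process eventually stops crashing. -/
theorem exists_fair_process {e : ℕ → Event n} {b : ℕ → Fin n → ℕ}
    (hb : ∀ t, b (t + 1) = recharge (b t) (e t)) (he : ∀ t, Affordable (b t) (e t)) :
    ∃ p, (∀ᶠ t in atTop, e t ≠ .crash p) ∧ ∃ᶠ t in atTop, e t = .step p := by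
  obtain ⟨p, hactive, hleast⟩ :=
    exists_frequently_eq_and_eventually_ge (l := atTop) fun t => (e t).process
  have hstable : ∀ᶠ t in atTop, ¬ b (t + 1) p < b t p :=
    eventually_not_lt_of_eventually_le (f := fun t => b t p) <|
      hleast.mono fun t ht => hb t ▸ recharge_le ht
  have hcrash : ∀ᶠ t in atTop, e t ≠ .crash p := hstable.mono fun t ht hcrash => by
    have hlt := hb t ▸ hcrash ▸ recharge_crash_lt (hcrash ▸ he t)
    exact ht hlt
  refine ⟨p, hcrash, (hactive.and_eventually hcrash).mono ?_⟩
  rintro t ⟨hp, hne⟩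
  cases het : e t with
  | step q => rw [← hp, het, Event.process]
  | crash q => rw [← hp, het] at hne; exact absurd rfl hne

end Budgets

end Algorithm

namespace ObjType

variable {ι κ : Type*} {T : ObjType.{u}} {op : ι → T.Op} {team : ι → Bool} {q r : T.State}
  {X : Bool}

/-- The state reached from `q` when the operations of the roles in `L` are applied in order. -/
def run (T : ObjType.{u}) (op : ι → T.Op) (q : T.State) (L : List ι) : T.State :=
  L.foldl (fun q i => T.next q (op i)) q

@[simp] theorem run_nil : T.run op q [] = q := rfl

theorem run_concat {L : List ι} {i : ι} :
    T.run op q (L ++ [i]) = T.next (T.run op q L) (op i) := by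
  simp [run]

theorem run_map {f : κ → ι} {L : List κ} :
    T.run op q (L.map f) = T.run (op ∘ f) q L := by
  simp [run, List.foldl_map]

/-- The states reached from `q` by applying operations of distinct roles, the first of which
belongs to team `X`. -/
def FirstBy (T : ObjType.{u}) (op : ι → T.Op) (team : ι → Bool) (q : T.State) (X : Bool) :
    Set T.State :=
  {r | ∃ i L, team i = X ∧ (i :: L).Nodup ∧ T.run op q (i :: L) = r}

theorem exists_of_mem_firstBy_comp {f : κ → ι} (hf : Function.Injective f)
    (hr : r ∈ T.FirstBy (op ∘ f) (team ∘ f) q X) :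
    ∃ i L, team i = X ∧ (i :: L).Nodup ∧ (∀ j ∈ i :: L, ∃ k, f k = j) ∧
      T.run op q (i :: L) = r := by
  obtain ⟨i, L, hi, hL, hr⟩ := hr
  exact ⟨f i, L.map f, hi, hL.map hf,
    fun j hj => (List.mem_map (l := i :: L).mp hj).imp fun _ hk => hk.2, run_map.trans hr⟩

/-- The operations of two nonempty teams record, in an object of type `T` with initial state `q`,
which team accessed the object first. Whether a team can bring the object back to `q` matters: we
name the teams such that only team `true` may be able to, in which case team `false` has just one
member. -/
structure IsRecording (T : ObjType.{u}) (q : T.State) (team : ι → Bool) (op : ι → T.Op) :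
    Prop where
  nonempty : ∀ X, ∃ i, team i = X
  disjoint : ∀ r ∈ T.FirstBy op team q true, r ∉ T.FirstBy op team q false
  fresh : q ∉ T.FirstBy op team q false
  single : q ∈ T.FirstBy op team q true → ∀ i j, team i = false → team j = false → i = j

theorem IsRecording.comp_equiv (h : T.IsRecording q team op) (e : κ ≃ ι) :
    T.IsRecording q (team ∘ e) (op ∘ e) := by
  have hsub : ∀ X, T.FirstBy (op ∘ e) (team ∘ e) q X ⊆ T.FirstBy op team q X := by
    intro X r hr
    obtain ⟨i, L, hi, hL, -, hr⟩ := exists_of_mem_firstBy_comp e.injective hr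
    exact ⟨i, L, hi, hL, hr⟩
  refine ⟨fun X => ?_, fun r hr hr' => h.disjoint r (hsub _ hr) (hsub _ hr'),
    fun hq => h.fresh (hsub _ hq), fun hq i j hi hj => e.injective (h.single (hsub _ hq) _ _ hi hj)⟩
  obtain ⟨i, hi⟩ := h.nonempty X
  exact ⟨e.symm i, by simpa using hi⟩

theorem exists_ne_of_two_teams [Fintype ι] (hcard : 3 ≤ Fintype.card ι)
    (hteam : ∀ X, ∃ i, team i = X) :
    ∃ x, (∀ X, ∃ i ≠ x, team i = X) ∧
      (team x = true → ∀ i j, team i = false → team j = false → i = j) := by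
  obtain ⟨⟨s, hs⟩, ⟨f, hf⟩⟩ := And.intro (hteam true) (hteam false)
  have hne : s ≠ f := fun h => by simp_all
  obtain ⟨x, hxs, hxf⟩ : ∃ x, x ≠ s ∧ x ≠ f := by
    classical
    obtain ⟨x, hx⟩ := Finset.exists_mem_notMem_of_card_lt_card (s := {s, f}) (t := Finset.univ)
      (by rw [Finset.card_pair hne, Finset.card_univ]; omega)
    exact ⟨x, by simpa using hx⟩
  have hkeep : ∀ X, ∃ i ≠ x, team i = X := fun X => by
    cases X
    · exact ⟨f, hxf.symm, hf⟩
    · exact ⟨s, hxs.symm, hs⟩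
  by_cases hsingle : ∀ i j, team i = false → team j = false → i = j
  · exact ⟨x, hkeep, fun _ => hsingle⟩
  push Not at hsingle
  obtain ⟨i, j, hi, hj, hij⟩ := hsingle
  refine ⟨i, fun X => ?_, by simp [hi]⟩
  cases X
  · exact ⟨j, hij.symm, hj⟩
  · exact ⟨s, fun h => by simp_all, hs⟩

/-- One role `x` is given up: if it belongs to team `false`, then `havoid` prevents team `true` from
bringing the object back to `q` without `x`; otherwise team `false` is a singleton. -/
theorem exists_isRecording_subtype [Fintype ι] (hcard : 3 ≤ Fintype.card ι)
    (hteam : ∀ X, ∃ i, team i = X)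
    (hdisj : ∀ {x i L i' L'}, (i :: L).Nodup → (i' :: L').Nodup → x ∉ i :: L → x ∉ i' :: L' →
      T.run op q (i :: L) = T.run op q (i' :: L') → team i = team i')
    (hfresh : ∀ {i L}, (i :: L).Nodup → T.run op q (i :: L) = q → team i = true)
    (havoid : ∀ {x i L}, (i :: L).Nodup → x ∉ i :: L → T.run op q (i :: L) = q →
      team i = team x) :
    ∃ x, T.IsRecording q (fun i : {i // i ≠ x} => team i) fun i => op i.1 := by
  obtain ⟨x, hkeep, hsingle⟩ := exists_ne_of_two_teams hcard hteam
  have hmem : ∀ {X r}, r ∈ T.FirstBy (fun i : {i // i ≠ x} => op i) (fun i => team i) q X →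
      ∃ i L, team i = X ∧ (i :: L).Nodup ∧ x ∉ i :: L ∧ T.run op q (i :: L) = r := by
    intro X r hr
    obtain ⟨i, L, hi, hL, hrange, hr⟩ :=
      exists_of_mem_firstBy_comp (f := Subtype.val) Subtype.val_injective hr
    exact ⟨i, L, hi, hL, fun hx => by simpa using hrange x hx, hr⟩
  refine ⟨x, fun X => ?_, fun r hr hr' => ?_, fun hq => ?_, fun hq i j hi hj => ?_⟩
  · obtain ⟨i, hix, hi⟩ := hkeep X
    exact ⟨⟨i, hix⟩, hi⟩
  · obtain ⟨i, L, hi, hL, hx, rfl⟩ := hmem hr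
    obtain ⟨i', L', hi', hL', hx', hrun⟩ := hmem hr'
    simpa [hi, hi'] using hdisj hL hL' hx hx' hrun.symm
  · obtain ⟨i, L, hi, hL, -, hrun⟩ := hmem hq
    simpa [hi] using hfresh hL hrun
  · obtain ⟨i', L, hi', hL, hx, hrun⟩ := hmem hq
    exact Subtype.ext (hsingle (havoid hL hx hrun ▸ hi') _ _ hi hj)

end ObjType

namespace Algorithm

variable {V : Type u} {𝒯 : Set ObjType.{u}} {n : ℕ} {A : Algorithm V 𝒯 n} {input input' : Fin n → V}
  {c c' : A.Config} {b b' : Fin n → ℕ} {p q : Fin n} {v w : V}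

/-- Some continuation of `c` that the crash budgets `b` afford makes a process return `v`. -/
def CanDecide (A : Algorithm V 𝒯 n) (input : Fin n → V) (c : A.Config) (b : Fin n → ℕ) (v : V) :
    Prop :=
  ∃ l, AffordableList b l ∧ ∃ p, A.HasOutput (A.execList input c l) p v

/-- The outcome is still open: two different values can be decided from `c` with budgets `b`. -/
def Bivalent (A : Algorithm V 𝒯 n) (input : Fin n → V) (c : A.Config) (b : Fin n → ℕ) : Prop :=
  ∃ v w, v ≠ w ∧ A.CanDecide input c b v ∧ A.CanDecide input c b w

/-- A reachable bivalent configuration in which each affordable event fixes the outcome; the step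
of the process `p` fixes it to `val p`. -/
structure IsCritical (A : Algorithm V 𝒯 n) (input : Fin n → V) (c : A.Config) (b : Fin n → ℕ)
    (val : Fin n → V) : Prop where
  reachable : A.Reachable input c
  bivalent : A.Bivalent input c b
  not_bivalent_exec : ∀ e, Affordable b e → ¬ A.Bivalent input (A.exec input c e) (recharge b e)
  canDecide_step : ∀ p,
    A.CanDecide input (A.exec input c (.step p)) (recharge b (.step p)) (val p)

theorem CanDecide.of_execList {l : List (Event n)} (hl : AffordableList b l)
    (h : A.CanDecide input (A.execList input c l) (l.foldl recharge b) v) :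
    A.CanDecide input c b v := by
  obtain ⟨l', hl', p, hp⟩ := h
  exact ⟨l ++ l', affordableList_append.mpr ⟨hl, hl'⟩, p, by rwa [execList_append]⟩

namespace SolvesRC

variable (h : A.SolvesRC)
include h

theorem exists_canDecide_of_indist (hc : A.Reachable input c) (hind : A.Indist p c c')
    (b b' : Fin n → ℕ) : ∃ v, A.CanDecide input c b v ∧ A.CanDecide input' c' b' v := by
  obtain ⟨k, v, hv⟩ := h.exists_hasOutput_replicate hc p
  have hv' : A.HasOutput (A.execList input' c' (List.replicate k (.step p))) p v := by
    rwa [HasOutput, ← (hind.execList_replicate (input := input) k).loc]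
  exact ⟨v, ⟨_, affordableList_replicate_step, p, hv⟩, _, affordableList_replicate_step, p, hv'⟩

theorem canDecide_initial (input : Fin n → V) (b : Fin n → ℕ) (p : Fin n) :
    A.CanDecide input (A.initial input) b (input p) := by
  obtain ⟨v, ⟨l, -, q, hq⟩, hv⟩ := h.exists_canDecide_of_indist (p := p)
    (input := fun _ => input p) (input' := input) (c' := A.initial input) ⟨[], rfl⟩ ⟨rfl, rfl⟩ b b
  obtain ⟨_, rfl⟩ := h.exists_eq_input (Reachable.execList ⟨[], rfl⟩ l) hq
  exact hv

theorem eq_of_hasOutput_of_canDecide (hc : A.Reachable input c) (hv : A.HasOutput c p v)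
    (hw : A.CanDecide input c b w) : v = w := by
  obtain ⟨l, -, q, hq⟩ := hw
  exact h.eq_of_hasOutput_execList hc hv hq

theorem not_hasOutput_of_bivalent (hc : A.Reachable input c) (hb : A.Bivalent input c b) :
    ¬ A.HasOutput c p v := by
  intro hv
  obtain ⟨u, w, huw, hu, hw⟩ := hb
  exact huw ((h.eq_of_hasOutput_of_canDecide hc hv hu).symm.trans
    (h.eq_of_hasOutput_of_canDecide hc hv hw))

theorem exists_bivalent_exec_of_forall_not_isCritical (hc : A.Reachable input c)
    (hb : A.Bivalent input c b) (hcrit : ∀ val, ¬ A.IsCritical input c b val) :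
    ∃ e, Affordable b e ∧ A.Bivalent input (A.exec input c e) (recharge b e) := by
  by_contra! huni
  choose val hval using fun p => h.exists_canDecide_of_indist (input' := input) (p := p)
    (hc.execList [.step p]) ⟨rfl, rfl⟩ (recharge b (.step p)) (recharge b (.step p))
  exact hcrit val ⟨hc, hb, huni, fun p => (hval p).1⟩

/-- Otherwise affordable events could keep the outcome open forever, although a process that
eventually stops crashing has to return a value. -/
theorem exists_isCritical (h₀ : A.Bivalent input (A.initial input) b) :
    ∃ c b val, A.IsCritical input c b val := by
  by_contra! hcon
  choose e haff hbiv using fun x : {x : A.Config × (Fin n → ℕ) //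
      A.Reachable input x.1 ∧ A.Bivalent input x.1 x.2} =>
    h.exists_bivalent_exec_of_forall_not_isCritical x.2.1 x.2.2 (hcon x.1.1 x.1.2)
  let seq : ℕ → {x : A.Config × (Fin n → ℕ) //
      A.Reachable input x.1 ∧ A.Bivalent input x.1 x.2} := fun t =>
    Nat.rec ⟨(A.initial input, b), ⟨[], rfl⟩, h₀⟩ (fun _ x =>
      ⟨(A.exec input x.1.1 (e x), recharge x.1.2 (e x)), x.2.1.execList [e x], hbiv x⟩) t
  have hconfig : ∀ t, A.config input (fun t => e (seq t)) t = (seq t).1.1 := by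
    intro t
    induction t with
    | zero => rfl
    | succ t ih => rw [config, ih]
  obtain ⟨p, hcrash, hstep⟩ := exists_fair_process (e := fun t => e (seq t))
    (b := fun t => (seq t).1.2) (fun _ => rfl) fun t => haff (seq t)
  obtain ⟨t₀, ht₀⟩ := eventually_atTop.mp hcrash
  obtain ⟨t, v, -, hv⟩ := h.waitFree input (fun t => e (seq t)) p t₀ ht₀
    (Nat.frequently_atTop_iff_infinite.mp hstep)
  rw [Outputs, hconfig] at hv
  exact h.not_hasOutput_of_bivalent (seq t).2.1 (seq t).2.2 hv

end SolvesRC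

namespace IsCritical

variable {val : Fin n → V} (hc : A.IsCritical input c b val)
include hc

theorem eq_val_of_canDecide
    (hv : A.CanDecide input (A.exec input c (.step p)) (recharge b (.step p)) v) : v = val p := by
  by_contra hne
  exact hc.not_bivalent_exec (.step p) trivial ⟨_, _, hne, hv, hc.canDecide_step p⟩

theorem val_eq_of_indist (h : A.SolvesRC) {i i' y : Fin n} {l l' : List (Event n)}
    (hl : AffordableList b (.step i :: l)) (hl' : AffordableList b (.step i' :: l'))
    (hind : A.Indist y (A.execList input c (.step i :: l)) (A.execList input c (.step i' :: l'))) :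
    val i = val i' := by
  obtain ⟨v, hv, hv'⟩ := h.exists_canDecide_of_indist (input' := input)
    (hc.reachable.execList _) hind (l.foldl recharge (recharge b (.step i)))
    (l'.foldl recharge (recharge b (.step i')))
  exact (hc.eq_val_of_canDecide (.of_execList hl.2 hv)).symm.trans
    (hc.eq_val_of_canDecide (.of_execList hl'.2 hv'))

theorem eq_val_of_canDecide_crash (h : A.SolvesRC) (hq : Affordable b (.crash q)) (hpq : p ≠ q)
    (hv : A.CanDecide input (A.exec input c (.crash q)) (recharge b (.crash q)) v) :
    v = val p := by
  obtain ⟨u, hu, hu'⟩ := h.exists_canDecide_of_indist (input' := input)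
    (hc.reachable.execList [.crash q, .step p])
    ((indist_exec_crash hpq).exec_step (input := input) (input' := input))
    (recharge (recharge b (.crash q)) (.step p)) (recharge b (.step p))
  rw [← hc.eq_val_of_canDecide hu']
  by_contra hne
  exact hc.not_bivalent_exec _ hq
    ⟨v, u, hne, hv, .of_execList (l := [.step p]) ⟨trivial, trivial⟩ hu⟩

theorem exists_val_ne [Nontrivial (Fin n)] (h : A.SolvesRC) : ∃ i j, val i ≠ val j := by
  by_contra! hall
  obtain ⟨p₀⟩ : Nonempty (Fin n) := inferInstance
  have hdecide : ∀ u, A.CanDecide input c b u → u = val p₀ := by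
    rintro u ⟨_ | ⟨e, l⟩, hl, p, hp⟩
    · exact absurd hp (h.not_hasOutput_of_bivalent hc.reachable hc.bivalent)
    have hu : A.CanDecide input (A.exec input c e) (recharge b e) u := ⟨l, hl.2, p, hp⟩
    cases e with
    | step q => rw [hc.eq_val_of_canDecide hu, hall q p₀]
    | crash q =>
      obtain ⟨r, hr⟩ := exists_ne q
      rw [hc.eq_val_of_canDecide_crash h hl.1 hr hu, hall r p₀]
  obtain ⟨v, w, hvw, hv, hw⟩ := hc.bivalent
  exact hvw ((hdecide v hv).trans (hdecide w hw).symm)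

theorem obj_eq_of_val_ne (h : A.SolvesRC) {o o' : A.Obj} {op : (A.kind o).Op}
    {op' : (A.kind o').Op} {k : (A.kind o).Resp → A.Loc} {k' : (A.kind o').Resp → A.Loc}
    (hp : A.action p (c.loc p) = .invoke o op k) (hq : A.action q (c.loc q) = .invoke o' op' k')
    (hval : val p ≠ val q) : o = o' := by
  by_contra ho
  have hcomm := exec_step_comm (input := input) (fun hpq => hval (congrArg val hpq)) ho hp hq
  exact hval (hc.val_eq_of_indist h (y := p) (l := [.step q]) (l' := [.step p])
    ⟨trivial, trivial, trivial⟩ ⟨trivial, trivial, trivial⟩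
    ⟨congrArg (fun c => c.loc p) hcomm, congrArg Config.shared hcomm⟩)

theorem exists_obj [Nontrivial (Fin n)] (h : A.SolvesRC) :
    ∃ (o : A.Obj) (op : Fin n → (A.kind o).Op) (k : Fin n → (A.kind o).Resp → A.Loc),
      ∀ p, A.action p (c.loc p) = .invoke o (op p) (k p) := by
  have hinvoke : ∀ p, ∃ o op k, A.action p (c.loc p) = .invoke o op k := fun p => by
    cases hact : A.action p (c.loc p) with
    | output v =>
      exact absurd hact (h.not_hasOutput_of_bivalent hc.reachable hc.bivalent)
    | invoke o op k => exact ⟨o, op, k, rfl⟩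
  choose obj hinvoke using hinvoke
  have hne : ∀ {i j}, val i ≠ val j → obj i = obj j := fun {i j} hij => by
    obtain ⟨⟨_, _, hi⟩, ⟨_, _, hj⟩⟩ := And.intro (hinvoke i) (hinvoke j)
    exact hc.obj_eq_of_val_ne h hi hj hij
  obtain ⟨i, j, hij⟩ := hc.exists_val_ne h
  have hobj : ∀ p, obj p = obj i := fun p => by
    by_cases hpi : val p = val i
    · exact (hne (hpi ▸ hij)).trans (hne hij).symm
    · exact hne hpi
  have hinvoke' : ∀ p, ∃ op k, A.action p (c.loc p) = .invoke (obj i) op k :=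
    fun p => hobj p ▸ hinvoke p
  choose op k hact using hinvoke'
  exact ⟨obj i, op, k, hact⟩

end IsCritical

section CommonObject

variable {o : A.Obj} {op : Fin n → (A.kind o).Op} {k : Fin n → (A.kind o).Resp → A.Loc}
  (hact : ∀ p, A.action p (c.loc p) = .invoke o (op p) (k p))
include hact

open Classical in
theorem execList_map_step_shared {L : List (Fin n)} (hL : L.Nodup) :
    (A.execList input c (L.map .step)).shared =
      Function.update c.shared o ((A.kind o).run op (c.shared o) L) := by
  induction L using List.reverseRecOn with
  | nil => simp
  | append_singleton L p ih =>
    obtain ⟨hL, -, hdisj⟩ := List.nodup_append.mp hL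
    have hp : p ∉ L := fun hp => hdisj p hp p (List.mem_singleton_self p) rfl
    rw [List.map_append, execList_append, List.map_singleton, execList_cons, execList_nil,
      exec_step_of_invoke ((execList_map_step_loc_of_notMem hp).symm ▸ hact p), ih hL]
    simp [ObjType.run_concat]

theorem execList_map_step_shared_of_run_eq_self {L : List (Fin n)} (hL : L.Nodup)
    (hrun : (A.kind o).run op (c.shared o) L = c.shared o) :
    (A.execList input c (L.map .step)).shared = c.shared := by
  classical
  rw [execList_map_step_shared hact hL, hrun, Function.update_eq_self]

namespace IsCritical

variable {val : Fin n → V} (hc : A.IsCritical input c b val) (h : A.SolvesRC) {i i' y : Fin n}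
  {L L' : List (Fin n)} (hL : (i :: L).Nodup)
include hc h hL

theorem val_eq_of_run_eq (hL' : (i' :: L').Nodup) (hy : y ∉ i :: L) (hy' : y ∉ i' :: L')
    (hrun : (A.kind o).run op (c.shared o) (i :: L) =
      (A.kind o).run op (c.shared o) (i' :: L')) : val i = val i' :=
  hc.val_eq_of_indist h (y := y) (l := L.map .step) (l' := L'.map .step)
    ⟨trivial, affordableList_map_step⟩ ⟨trivial, affordableList_map_step⟩
    ⟨(execList_map_step_loc_of_notMem hy).trans (execList_map_step_loc_of_notMem hy').symm, by
      rw [← List.map_cons, ← List.map_cons, execList_map_step_shared hact hL,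
        execList_map_step_shared hact hL', hrun]⟩

theorem val_eq_of_run_eq_self (hy : y ∉ i :: L)
    (hrun : (A.kind o).run op (c.shared o) (i :: L) = c.shared o) : val i = val y := by
  have hind : A.Indist y (A.execList input c ((i :: L).map .step)) c :=
    ⟨execList_map_step_loc_of_notMem hy, execList_map_step_shared_of_run_eq_self hact hL hrun⟩
  refine hc.val_eq_of_indist h (y := y) (l := L.map .step ++ [.step y]) (l' := [])
    ⟨trivial, affordableList_append.mpr
      ⟨affordableList_map_step, affordableList_map_step (L := [y])⟩⟩
    ⟨trivial, trivial⟩ ?_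
  rw [← List.cons_append, ← List.map_cons, execList_append]
  exact hind.exec_step (input := input) (input' := input)

/-- The step of `a` pays for a crash of `z`, after which `z` cannot tell the two runs apart. -/
theorem val_eq_of_mem_of_lt {a z : Fin n} (haz : a < z) (ha : a ∈ i :: L) (ha' : a ∈ i' :: L')
    (hL' : (i' :: L').Nodup) (hrun : (A.kind o).run op (c.shared o) (i :: L) = c.shared o)
    (hrun' : (A.kind o).run op (c.shared o) (i' :: L') = c.shared o) : val i = val i' := by
  have haff : ∀ {i L}, a ∈ i :: L → AffordableList b (.step i :: (L.map .step ++ [.crash z])) :=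
    fun {i L} ha => by
      rw [← List.cons_append, ← List.map_cons, affordableList_append]
      exact ⟨affordableList_map_step, foldl_recharge_map_step_pos (.inr ⟨a, ha, haz⟩), trivial⟩
  refine hc.val_eq_of_indist h (y := z) (haff ha) (haff ha') ?_
  rw [← List.cons_append, ← List.cons_append, ← List.map_cons, ← List.map_cons, execList_append,
    execList_append]
  refine ⟨exec_crash_loc_self.trans exec_crash_loc_self.symm, ?_⟩
  exact (execList_map_step_shared_of_run_eq_self hact hL hrun).trans
    (execList_map_step_shared_of_run_eq_self hact hL' hrun').symm

theorem val_eq_of_run_eq_self_of_run_eq_self (hL' : (i' :: L').Nodup)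
    (hrun : (A.kind o).run op (c.shared o) (i :: L) = c.shared o)
    (hrun' : (A.kind o).run op (c.shared o) (i' :: L') = c.shared o) : val i = val i' := by
  by_cases hi : i ∈ i' :: L'
  · by_cases hi' : i' ∈ i :: L
    · rcases lt_trichotomy i i' with hlt | rfl | hlt
      · exact hc.val_eq_of_mem_of_lt hact h hL hlt List.mem_cons_self hi hL' hrun hrun'
      · rfl
      · exact hc.val_eq_of_mem_of_lt hact h hL hlt hi' List.mem_cons_self hL' hrun hrun'
    · exact hc.val_eq_of_run_eq_self hact h hL hi' hrun
  · exact (hc.val_eq_of_run_eq_self hact h hL' hi hrun').symm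

end IsCritical

end CommonObject

theorem IsCritical.exists_isRecording {val : Fin n → V} (hc : A.IsCritical input c b val)
    (h : A.SolvesRC) (hn : 3 ≤ n) :
    ∃ (o : A.Obj) (x : Fin n) (team : {i // i ≠ x} → Bool) (op : {i // i ≠ x} → (A.kind o).Op),
      (A.kind o).IsRecording (c.shared o) team op := by
  classical
  have : Nontrivial (Fin n) := Fin.nontrivial_iff_two_le.mpr (by omega)
  obtain ⟨o, op, k, hact⟩ := hc.exists_obj h
  -- Team `true` wants the value of the processes that can restore the object, if there are any.
  obtain ⟨s, hs⟩ : ∃ s, ∀ {i L}, (i :: L).Nodup →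
      (A.kind o).run op (c.shared o) (i :: L) = c.shared o → val i = val s := by
    by_cases hrestore : ∃ i L, (i :: L).Nodup ∧
        (A.kind o).run op (c.shared o) (i :: L) = c.shared o
    · obtain ⟨s, L', hL', hrun'⟩ := hrestore
      exact ⟨s, fun hL hrun =>
        hc.val_eq_of_run_eq_self_of_run_eq_self hact h hL hL' hrun hrun'⟩
    · exact ⟨⟨0, by omega⟩, fun hL hrun => absurd ⟨_, _, hL, hrun⟩ hrestore⟩
  have hteam : ∀ X, ∃ i, decide (val i = val s) = X := by
    obtain ⟨i, j, hij⟩ := hc.exists_val_ne h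
    have hother : ∃ i, val i ≠ val s := by
      by_contra! hall
      exact hij ((hall i).trans (hall j).symm)
    exact Bool.rec (by simpa using hother) ⟨s, by simp⟩
  obtain ⟨x, hrec⟩ := ObjType.exists_isRecording_subtype (q := c.shared o) (op := op)
    (by simpa using hn) hteam
    (fun hL hL' hx hx' hrun => by rw [hc.val_eq_of_run_eq hact h hL hL' hx hx' hrun])
    (fun hL hrun => decide_eq_true (hs hL hrun))
    (fun hL hx hrun => by rw [hc.val_eq_of_run_eq_self hact h hL hx hrun])
  exact ⟨o, x, _, _, hrec⟩

theorem SolvesRC.exists_isRecording [Nontrivial V] (h : A.SolvesRC) (hn : 3 ≤ n) :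
    ∃ (o : A.Obj) (q : (A.kind o).State) (x : Fin n) (team : {i // i ≠ x} → Bool)
      (op : {i // i ≠ x} → (A.kind o).Op), (A.kind o).IsRecording q team op := by
  classical
  have : Nontrivial (Fin n) := Fin.nontrivial_iff_two_le.mpr (by omega)
  obtain ⟨v, w, hvw⟩ := exists_pair_ne V
  obtain ⟨p, q, hpq⟩ := exists_pair_ne (Fin n)
  let input : Fin n → V := Function.update (fun _ => w) p v
  have hne : input p ≠ input q := by simpa [input, hpq.symm] using hvw
  obtain ⟨c, b, val, hc⟩ := h.exists_isCritical (input := input) (b := 0)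
    ⟨_, _, hne, h.canDecide_initial _ _ p, h.canDecide_initial _ _ q⟩
  obtain ⟨o, x, team, op, hrec⟩ := hc.exists_isRecording h hn
  exact ⟨o, _, x, team, op, hrec⟩

end Algorithm

/-- The phases of the program that a process executes in a match: write its value to the register
of its team, look at the recording object, check whether the other team has written its value,
access the recording object, look at it once more, and fetch the value of team `X`. -/
inductive Phase : Type
  | write
  | look
  | check
  | apply
  | relook
  | fetch (X : Bool)

theorem ObjType.IsRecording.mem_of_run_eq {ι : Type*} {T : ObjType.{u}} {q : T.State}
    {team : ι → Bool} {op : ι → T.Op} (h : T.IsRecording q team op) {i j : ι} {L : List ι}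
    (hi : team i = true) (hj : team j = false) (hL : (i :: L).Nodup)
    (hrun : T.run op q (i :: L) = q) : j ∈ i :: L := by
  by_contra hmem
  refine h.disjoint (T.next q (op j)) ⟨i, L ++ [j], hi, ?_, ?_⟩ ⟨j, [], hj, by simp, rfl⟩
  · rw [← List.cons_append, ← List.concat_eq_append]
    exact hL.concat hmem
  · rw [← List.cons_append, ObjType.run_concat, hrun]

/-- The state of a match between two teams: the recording object, the registers of the teams, the
roles that have accessed the object since it was last known to be in its initial state, in order,
and the winning team, if any. The last two components only serve the correctness proof. -/
structure MatchState (V : Type*) (T : ObjType.{u}) (ι : Type*) where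
  obj : T.State
  reg : Bool → Option V
  log : List ι
  winner : Option Bool

namespace MatchState

variable {V ι : Type*} {T : ObjType.{u}}

/-- The value on which the players of a match agree. -/
def outcome (M : MatchState V T ι) : Option V := M.winner.bind M.reg

/-- The match has not begun yet. -/
def start (q : T.State) : MatchState V T ι := ⟨q, fun _ => none, [], none⟩

/-- Some player with role `i` accesses the object and makes its team win unless there is a winner
already. -/
def accessBy (M : MatchState V T ι) (team : ι → Bool) (op : ι → T.Op) (i : ι) :
    MatchState V T ι where
  obj := T.next M.obj (op i)
  reg := M.reg
  log := M.log ++ [i]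
  winner := some (M.winner.getD (team i))

/-- The invariant of a match with initial state `q` of the object. A winner without accesses in the
log is possible only if team `true` has restored the state `q`, or was conceded the victory since
it could have. -/
structure Valid (M : MatchState V T ι) (q : T.State) (team : ι → Bool) (op : ι → T.Op) :
    Prop where
  nodup : M.log.Nodup
  obj_eq : M.obj = T.run op q M.log
  head : ∀ {i L}, M.log = i :: L → M.winner = some (team i)
  announced : ∀ {X}, M.winner = some X → (M.reg X).isSome
  restored : ∀ {X}, M.winner = some X → M.log = [] → X = true ∧ q ∈ T.FirstBy op team q true

/-- The invariant of a player with role `i` in a given phase of a match. -/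
def PhaseValid (M : MatchState V T ι) (q : T.State) (team : ι → Bool) (op : ι → T.Op) (i : ι) :
    Phase → Prop
  | .write => True
  | .look => (M.reg (team i)).isSome
  | .check => (M.reg (team i)).isSome ∧ i ∉ M.log ∧ q ∈ T.FirstBy op team q true ∧
      team i = false ∧ M.winner ≠ some false
  | .apply => (M.reg (team i)).isSome ∧ i ∉ M.log ∧
      (M.winner = some true → M.log = [] → team i = true)
  | .relook => M.winner ≠ none
  | .fetch X => M.winner = some X

/-- A change from `M` to `N` that a player with role `i` may cause. -/
structure IsMove (q : T.State) (team : ι → Bool) (op : ι → T.Op) (i : ι)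
    (M N : MatchState V T ι) : Prop where
  valid : N.Valid q team op
  outcome_mono : ∀ {v}, M.outcome = some v → N.outcome = some v
  others : ∀ {j f}, j ≠ i → M.PhaseValid q team op j f → N.PhaseValid q team op j f

variable {q : T.State} {team : ι → Bool} {op : ι → T.Op} {i : ι} {M : MatchState V T ι}

theorem outcome_eq_some {X : Bool} {v : V} (hX : M.winner = some X) (hv : M.reg X = some v) :
    M.outcome = some v := by
  rw [outcome, hX, Option.bind_some, hv]

theorem exists_reg_eq_of_outcome {v : V} (h : M.outcome = some v) : ∃ X, M.reg X = some v :=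
  (Option.bind_eq_some_iff.mp h).imp fun _ => And.right

theorem valid_start : (start q : MatchState V T ι).Valid q team op :=
  ⟨List.nodup_nil, rfl, nofun, nofun, nofun⟩

namespace Valid

theorem isMove_self (h : M.Valid q team op) : IsMove q team op i M M :=
  ⟨h, id, fun _ => id⟩

theorem mem_firstBy (h : M.Valid q team op) (hlog : M.log ≠ []) :
    ∃ X, M.winner = some X ∧ M.obj ∈ T.FirstBy op team q X := by
  obtain ⟨i, L, hL⟩ := List.exists_cons_of_ne_nil hlog
  exact ⟨_, h.head hL, i, L, rfl, hL ▸ h.nodup, by rw [h.obj_eq, hL]⟩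

open Classical in
/-- A player who sees that the match has begun can tell the winner. -/
theorem winner_eq (h : M.Valid q team op) (hT : T.IsRecording q team op)
    (hbegun : M.obj ≠ q ∨ M.winner ≠ none) :
    M.winner = some (decide (M.obj ∈ T.FirstBy op team q true)) := by
  by_cases hlog : M.log = []
  · have hobj : M.obj = q := by rw [h.obj_eq, hlog, ObjType.run_nil]
    obtain ⟨X, hX⟩ := Option.ne_none_iff_exists'.mp (hbegun.resolve_left (not_not.mpr hobj))
    obtain ⟨rfl, hmem⟩ := h.restored hX hlog
    simpa [hobj, hmem] using hX
  · obtain ⟨X, hX, hmem⟩ := h.mem_firstBy hlog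
    cases X
    · have hnot : M.obj ∉ T.FirstBy op team q true := fun h' => hT.disjoint _ h' hmem
      simpa [hnot] using hX
    · simpa [hmem] using hX

theorem restored_of_obj_eq (h : M.Valid q team op) (hT : T.IsRecording q team op)
    (hobj : M.obj = q) {X : Bool} (hX : M.winner = some X) :
    X = true ∧ q ∈ T.FirstBy op team q true := by
  by_cases hlog : M.log = []
  · exact h.restored hX hlog
  obtain ⟨Y, hY, hmem⟩ := h.mem_firstBy hlog
  obtain rfl : X = Y := Option.some.inj (hX.symm.trans hY)
  rw [hobj] at hmem
  cases X
  · exact absurd hmem hT.fresh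
  · exact ⟨rfl, hmem⟩

theorem isMove_announce (h : M.Valid q team op) {X : Bool} {v : V}
    (hv : ∀ {w}, M.reg X = some w → w = v) :
    IsMove q team op i M { M with reg := Function.update M.reg X (some v) } := by
  have hreg : ∀ {Y w}, M.reg Y = some w → Function.update M.reg X (some v) Y = some w := by
    intro Y w hw
    obtain rfl | hY := eq_or_ne Y X
    · rw [Function.update_self, hv hw]
    · rwa [Function.update_of_ne hY]
  have hsome : ∀ {Y}, (M.reg Y).isSome → (Function.update M.reg X (some v) Y).isSome := by
    intro Y hY
    obtain ⟨w, hw⟩ := Option.isSome_iff_exists.mp hY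
    exact Option.isSome_iff_exists.mpr ⟨w, hreg hw⟩
  refine ⟨⟨h.nodup, h.obj_eq, h.head, fun hX => hsome (h.announced hX), h.restored⟩, ?_, ?_⟩
  · intro w hw
    obtain ⟨Y, hY, hw⟩ := Option.bind_eq_some_iff.mp hw
    exact outcome_eq_some hY (hreg hw)
  · intro j f _ hf
    cases f with
    | write | relook | fetch => exact hf
    | look => exact hsome hf
    | check | apply => exact ⟨hsome hf.1, hf.2⟩

theorem isMove_reset (h : M.Valid q team op) (hT : T.IsRecording q team op) (hobj : M.obj = q) :
    IsMove q team op i M { M with log := [] } := by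
  refine ⟨⟨List.nodup_nil, hobj, nofun, h.announced, fun hX _ => h.restored_of_obj_eq hT hobj hX⟩,
    id, fun {j f} _ hf => ?_⟩
  cases f with
  | write | look | relook | fetch => exact hf
  | check => exact ⟨hf.1, List.not_mem_nil, hf.2.2⟩
  | apply =>
    refine ⟨hf.1, List.not_mem_nil, fun hwin _ => ?_⟩
    by_contra hj
    cases hlog : M.log with
    | nil => exact hj (hf.2.2 hwin hlog)
    | cons k L =>
      have hk : team k = true := Option.some.inj ((h.head hlog).symm.trans hwin)
      refine hf.2.1 (hlog ▸ hT.mem_of_run_eq hk (by simpa using hj) (hlog ▸ h.nodup) ?_)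
      rw [← hlog, ← h.obj_eq, hobj]

theorem phaseValid_check_reset (h : M.Valid q team op) (hT : T.IsRecording q team op)
    (hobj : M.obj = q) (hi : M.PhaseValid q team op i .look)
    (hc : q ∈ T.FirstBy op team q true ∧ team i = false) :
    PhaseValid { M with log := [] } q team op i .check :=
  ⟨hi, List.not_mem_nil, hc.1, hc.2, fun hX =>
    Bool.false_ne_true (h.restored_of_obj_eq hT hobj hX).1⟩

theorem phaseValid_apply_reset (h : M.Valid q team op) (hT : T.IsRecording q team op)
    (hobj : M.obj = q) (hi : M.PhaseValid q team op i .look)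
    (hc : ¬(q ∈ T.FirstBy op team q true ∧ team i = false)) :
    PhaseValid { M with log := [] } q team op i .apply := by
  refine ⟨hi, List.not_mem_nil, fun hX _ => ?_⟩
  by_contra hfalse
  exact hc ⟨(h.restored_of_obj_eq hT hobj hX).2, by simpa using hfalse⟩

theorem phaseValid_apply_of_check (h : M.Valid q team op) (hreg : M.reg true = none)
    (hi : M.PhaseValid q team op i .check) : M.PhaseValid q team op i .apply :=
  ⟨hi.1, hi.2.1, fun hX => by simpa [hreg] using h.announced hX⟩

/-- The only member of team `false` may concede the victory: nobody else of this team is about to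
access the object. -/
theorem isMove_concede (h : M.Valid q team op) (hT : T.IsRecording q team op)
    (hreg : (M.reg true).isSome) (hi : M.PhaseValid q team op i .check) :
    IsMove q team op i M { M with winner := some true } := by
  obtain ⟨-, -, hq, hfalse, hwin⟩ := hi
  have hwin : ∀ {X}, M.winner = some X → true = X := by
    rintro (_ | _) hX
    · exact absurd hX hwin
    · rfl
  refine ⟨⟨h.nodup, h.obj_eq, ?_, ?_, ?_⟩, ?_, fun {j f} hj hf => ?_⟩
  · exact fun hL => congrArg some (hwin (h.head hL))
  · rintro _ ⟨⟩
    exact hreg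
  · rintro _ ⟨⟩ -
    exact ⟨rfl, hq⟩
  · intro v hv
    obtain ⟨X, hX, hv⟩ := Option.bind_eq_some_iff.mp hv
    exact outcome_eq_some (X := true) rfl (hwin hX ▸ hv)
  · cases f with
    | write | look => exact hf
    | check => exact ⟨hf.1, hf.2.1, hf.2.2.1, hf.2.2.2.1, nofun⟩
    | apply =>
      refine ⟨hf.1, hf.2.1, fun _ _ => ?_⟩
      by_contra hj'
      exact hj (hT.single hq j i (by simpa using hj') hfalse)
    | relook => exact nofun
    | fetch X => exact congrArg some (hwin hf)

theorem accessBy (h : M.Valid q team op) (hi : M.PhaseValid q team op i .apply) :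
    (M.accessBy team op i).Valid q team op := by
  obtain ⟨hreg, hlog, hlate⟩ := hi
  refine ⟨?_, ?_, ?_, ?_, ?_⟩
  · change (M.log ++ [i]).Nodup
    simpa only [List.concat_eq_append] using h.nodup.concat hlog
  · exact (congrArg (T.next · (op i)) h.obj_eq).trans ObjType.run_concat.symm
  · intro j L hL
    change some (M.winner.getD (team i)) = some (team j)
    cases hM : M.log with
    | cons k L' =>
      obtain rfl : k = j := (List.cons.inj (by simpa [MatchState.accessBy, hM] using hL)).1
      rw [h.head hM, Option.getD_some]
    | nil =>
      obtain rfl : i = j := (List.cons.inj (by simpa [MatchState.accessBy, hM] using hL)).1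
      cases hX : M.winner with
      | none => rfl
      | some X =>
        obtain ⟨rfl, -⟩ := h.restored hX hM
        rw [hlate hX hM, Option.getD_some]
  · rintro _ ⟨⟩
    cases hX : M.winner with
    | none => exact hreg
    | some X => exact h.announced hX
  · exact fun _ hnil => absurd hnil (by simp [MatchState.accessBy])

theorem isMove_accessBy (h : M.Valid q team op) (hT : T.IsRecording q team op)
    (hi : M.PhaseValid q team op i .apply) : IsMove q team op i M (M.accessBy team op i) := by
  have hwin : ∀ {X}, M.winner = some X → (M.accessBy team op i).winner = some X := fun hX =>
    congrArg some (by rw [hX, Option.getD_some])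
  refine ⟨h.accessBy hi, ?_, fun {j f} hj hf => ?_⟩
  · intro v hv
    obtain ⟨X, hX, hv⟩ := Option.bind_eq_some_iff.mp hv
    exact outcome_eq_some (hwin hX) hv
  have hlog : j ∉ M.log → j ∉ (M.accessBy team op i).log := by
    simp [MatchState.accessBy, hj]
  cases f with
  | write | look => exact hf
  | check =>
    refine ⟨hf.1, hlog hf.2.1, hf.2.2.1, hf.2.2.2.1, fun hfalse => ?_⟩
    cases hX : M.winner with
    | none =>
      have hi : team i = false := by simpa [MatchState.accessBy, hX] using hfalse
      exact hj (hT.single hf.2.2.1 j i hf.2.2.2.1 hi)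
    | some X => exact hf.2.2.2.2 (hX.trans ((hwin hX).symm.trans hfalse))
  | apply => exact ⟨hf.1, hlog hf.2.1, fun _ hnil => absurd hnil (by simp [MatchState.accessBy])⟩
  | relook => exact nofun
  | fetch X => exact hwin hf

end Valid

end MatchState

/-- What it takes to let processes `P` play a tournament with objects of type `T`: a recording
initial state, a captain of each team, and an operation that reads the object. -/
structure Tournament (T : ObjType.{u}) (P : Type*) where
  start : T.State
  team : P → Bool
  op : P → T.Op
  recording : T.IsRecording start team op
  captain : Bool → P
  team_captain : ∀ X, team (captain X) = X
  read : T.Op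
  next_read : ∀ q, T.next q read = q
  resp_read_injective : Function.Injective fun q => T.resp q read

namespace Tournament

section Bracket

variable {P : Type*} {T : ObjType.{u}} [LinearOrder P] (G : Tournament T P)

/-- Process `p` takes part in match `m`. The final match `⊤` is between the two teams. In match `s`,
process `s` plays against the smaller members of its team, who already agree on a value. -/
def TakesPart (m : WithTop P) (p : P) : Prop :=
  p ≤ m ∧ ∀ s : P, m = s → G.team p = G.team s

/-- The role of `p` in match `m`: in its first match, `p` stands in for the captain of the other
team. -/
def role (m : WithTop P) (p : P) : P := if m = p then G.captain (!G.team p) else p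

variable {G} {m : WithTop P} {p p' s s' : P}

theorem takesPart_self : G.TakesPart p p :=
  ⟨le_rfl, fun _ h => congrArg G.team (WithTop.coe_injective h)⟩

theorem role_self : G.role p p = G.captain (!G.team p) := if_pos rfl

theorem role_of_ne (h : m ≠ p) : G.role m p = p := if_neg h

theorem TakesPart.role_ne_role_self (h : G.TakesPart s p) (hne : (s : WithTop P) ≠ p) :
    G.role s p ≠ G.role s s := by
  rw [role_self, role_of_ne hne]
  intro hp
  simpa [hp, G.team_captain] using h.2 s rfl

theorem TakesPart.role_inj (h : G.TakesPart m p) (h' : G.TakesPart m p')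
    (hrole : G.role m p = G.role m p') : p = p' := by
  by_cases hp : m = p <;> by_cases hp' : m = p'
  · exact WithTop.coe_injective (hp.symm.trans hp')
  · subst hp
    exact absurd hrole.symm (h'.role_ne_role_self hp')
  · subst hp'
    exact absurd hrole (h.role_ne_role_self hp)
  · rwa [role_of_ne hp, role_of_ne hp'] at hrole

variable [Fintype P]

variable (G) in
/-- The match that follows match `s` for those who take part in it: they are joined by the next
member of their team, or meet the other team in the final match. -/
def nextMatch (s : P) : WithTop P :=
  (Finset.univ.filter fun p => s < p ∧ G.team p = G.team s).min

theorem lt_nextMatch : s < G.nextMatch s := by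
  cases h : G.nextMatch s with
  | top => exact WithTop.coe_lt_top s
  | coe p => exact WithTop.coe_lt_coe.mpr (Finset.mem_filter.mp (Finset.mem_of_min h)).2.1

theorem team_eq_of_nextMatch_eq (h : G.nextMatch s = p) : G.team p = G.team s :=
  (Finset.mem_filter.mp (Finset.mem_of_min h)).2.2

theorem nextMatch_le (hlt : s < p) (hteam : G.team p = G.team s) : G.nextMatch s ≤ p :=
  Finset.min_le (Finset.mem_filter.mpr ⟨Finset.mem_univ p, hlt, hteam⟩)

theorem eq_of_nextMatch_eq (hteam : G.team s = G.team s')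
    (h : G.nextMatch s = G.nextMatch s') : s = s' := by
  by_contra hne
  wlog hlt : s < s' generalizing s s'
  · exact this hteam.symm h.symm (Ne.symm hne) (lt_of_le_of_ne (not_lt.mp hlt) (Ne.symm hne))
  exact (nextMatch_le hlt hteam.symm).not_gt (h ▸ lt_nextMatch)

theorem TakesPart.ne_nextMatch (h : G.TakesPart s p) : G.nextMatch s ≠ p :=
  (h.1.trans_lt lt_nextMatch).ne'

theorem TakesPart.next (h : G.TakesPart s p) : G.TakesPart (G.nextMatch s) p :=
  ⟨(h.1.trans_lt lt_nextMatch).le, fun _ hs' =>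
    (h.2 s rfl).trans (team_eq_of_nextMatch_eq hs').symm⟩

/-- The number of matches, other than the final one, that do not precede match `m` in the order of
the matches. It bounds the number of matches that remain to be played. -/
def height (m : WithTop P) : ℕ := (Finset.univ.filter fun p : P => m ≤ p).card

theorem height_nextMatch_lt : height (G.nextMatch s) < height (s : WithTop P) := by
  refine Finset.card_lt_card (Finset.ssubset_iff_of_subset ?_ |>.mpr ⟨s, ?_, ?_⟩)
  · exact Finset.monotone_filter_right _ fun p _ hp => lt_nextMatch.le.trans hp
  · simp
  · simpa using lt_nextMatch

end Bracket

section Proposes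

variable {V P : Type*} {T : ObjType.{u}} [LinearOrder P] [Fintype P] (G : Tournament T P)
  {m : WithTop P} {p s : P} {X : Bool} {input : P → V}
  {out out' : WithTop P → Option V} {v w : V}

/-- The value with which team `X` enters match `m`, where `out` gives the outcomes of the matches
and `input` the inputs of the processes. -/
def Proposes (input : P → V) (out : WithTop P → Option V) (m : WithTop P) (X : Bool) (v : V) :
    Prop :=
  (∃ p : P, m = p ∧ X = !G.team p ∧ input p = v) ∨
    ∃ s : P, m = G.nextMatch s ∧ X = G.team s ∧ out s = some v

variable {G}

theorem proposes_input : G.Proposes input out p (G.team (G.role p p)) (input p) :=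
  .inl ⟨p, rfl, by rw [role_self, G.team_captain], rfl⟩

theorem TakesPart.proposes_next (h : G.TakesPart s p) (hv : out s = some v) :
    G.Proposes input out (G.nextMatch s) (G.team (G.role (G.nextMatch s) p)) v :=
  .inr ⟨s, rfl, by rw [role_of_ne h.ne_nextMatch, h.2 s rfl], hv⟩

theorem Proposes.mono (h : G.Proposes input out m X v)
    (hout : ∀ {m v}, out m = some v → out' m = some v) : G.Proposes input out' m X v :=
  h.imp_right fun ⟨s, hs⟩ => ⟨s, hs.1, hs.2.1, hout hs.2.2⟩

theorem Proposes.unique (h : G.Proposes input out m X v) (h' : G.Proposes input out m X w) :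
    v = w := by
  have hmixed : ∀ {p s : P}, m = p → X = !G.team p → m = G.nextMatch s → X ≠ G.team s :=
    fun hp hX hs hX' => by
      simpa [← hX', hX] using team_eq_of_nextMatch_eq (hs.symm.trans hp)
  obtain ⟨p, hp, hX, rfl⟩ | ⟨s, hs, hX, hv⟩ := h <;>
    obtain ⟨p', hp', hX', rfl⟩ | ⟨s', hs', hX', hw⟩ := h'
  · rw [WithTop.coe_injective (hp.symm.trans hp')]
  · exact absurd hX' (hmixed hp hX hs')
  · exact absurd hX (hmixed hp' hX' hs)
  · obtain rfl := eq_of_nextMatch_eq (hX.symm.trans hX') (hs.symm.trans hs')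
    exact Option.some.inj (hv.symm.trans hw)

theorem exists_eq_input (hout : ∀ {m v}, out m = some v → ∃ X, G.Proposes input out m X v)
    (hv : out m = some v) : ∃ p, v = input p := by
  induction m using WellFoundedLT.induction generalizing v with
  | ind m ih =>
    obtain ⟨X, ⟨p, -, -, rfl⟩ | ⟨s, rfl, -, hs⟩⟩ := hout hv
    · exact ⟨p, rfl⟩
    · exact ih s lt_nextMatch hs

end Proposes

section Program

variable {T : ObjType.{u}} {n : ℕ}

/-- The shared objects of the tournament: the recording object of match `m` and, for each team `X`,
the register of this team in match `m`. -/
inductive Cell (n : ℕ) : Type u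
  | obj (m : WithTop (Fin n))
  | reg (m : WithTop (Fin n)) (X : Bool)

/-- The local states of a process: in phase `f` of match `m`, which it entered with the value `v`,
or done after returning `v`. -/
inductive Loc (V : Type u) (n : ℕ) : Type u
  | running (m : WithTop (Fin n)) (f : Phase) (v : V)
  | done (v : V)

/-- The types of the shared objects. A register is empty until a team writes its value. -/
abbrev kind (V : Type u) (T : ObjType.{u}) : Cell.{u} n → ObjType.{u}
  | .obj _ => T
  | .reg _ _ => registerType (Option V)

variable {V : Type u} (G : Tournament T (Fin n))

/-- How a process goes on when it knows the outcome `v` of match `m`. -/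
def finish (m : WithTop (Fin n)) (v : V) : Loc V n :=
  WithTop.recTopCoe (.done v) (fun s => .running (G.nextMatch s) .write v) m

open Classical in
/-- How a process goes on when it has read `r` from the recording object of match `m` and knows that
the match has begun. -/
noncomputable def afterRead (m : WithTop (Fin n)) (v : V) (r : T.Resp) : Loc V n :=
  .running m (.fetch (decide (∃ q ∈ T.FirstBy G.op G.team G.start true, T.resp q G.read = r))) v

open Classical in
/-- The program of process `p`. A process of a team `false` that may have been the first although
the object looks untouched must check whether team `true` takes part; if so, it lets this team
win. -/
noncomputable def action (p : Fin n) : Loc V n → NextAction V (kind (n := n) V T) (Loc V n)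
  | .running m .write v =>
    .invoke (.reg m (G.team (G.role m p))) (.write (some v)) fun _ => .running m .look v
  | .running m .look v => .invoke (.obj m) G.read fun r =>
    if r = T.resp G.start G.read then
      if G.start ∈ T.FirstBy G.op G.team G.start true ∧ G.team (G.role m p) = false then
        .running m .check v
      else .running m .apply v
    else G.afterRead m v r
  | .running m .check v => .invoke (.reg m true) .read fun r =>
    (Option.join r).elim (.running m .apply v) (G.finish m)
  | .running m .apply v => .invoke (.obj m) (G.op (G.role m p)) fun _ => .running m .relook v
  | .running m .relook v => .invoke (.obj m) G.read (G.afterRead m v)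
  | .running m (.fetch X) v => .invoke (.reg m X) .read fun r => G.finish m ((Option.join r).getD v)
  | .done v => .output v

/-- Process `p` starts in match `p`, which is the first one in which it takes part. -/
noncomputable def algorithm (V : Type u) {𝒯 : Set ObjType.{u}} (hT : T ∈ 𝒯 ∪ registers) :
    Algorithm V (𝒯 ∪ registers) n where
  Obj := Cell n
  kind := kind V T
  kind_mem
    | .obj _ => hT
    | .reg _ _ => .inr ⟨Option V, rfl⟩
  initShared
    | .obj _ => G.start
    | .reg _ _ => (none : Option V)
  Loc := Loc V n
  initLocal p v := .running p .write v
  action := G.action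

variable {G} {m : WithTop (Fin n)} {p : Fin n} {v : V}

open Classical in
theorem afterRead_resp {q : T.State} : G.afterRead m v (T.resp q G.read) =
    .running m (.fetch (decide (q ∈ T.FirstBy G.op G.team G.start true))) v := by
  have hiff : (∃ r ∈ T.FirstBy G.op G.team G.start true, T.resp r G.read = T.resp q G.read) ↔
      q ∈ T.FirstBy G.op G.team G.start true :=
    ⟨fun ⟨r, hr, heq⟩ => G.resp_read_injective heq ▸ hr, fun hq => ⟨q, hq, rfl⟩⟩
  simp only [afterRead, hiff]

theorem eq_done_of_action_eq_output {ℓ : Loc V n} (h : G.action p ℓ = .output v) :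
    ℓ = .done v := by
  cases ℓ with
  | done w => rw [NextAction.output.inj h]
  | running m f w => cases f <;> exact nomatch h

end Program

section Rank

variable {V : Type u} {T : ObjType.{u}} {n : ℕ} {G : Tournament T (Fin n)}

/-- A bound on the number of steps that remain in a match. -/
def phaseRank : Phase → ℕ
  | .write => 6
  | .look => 5
  | .check => 4
  | .apply => 3
  | .relook => 2
  | .fetch _ => 1

/-- A bound on the number of steps that a process takes before it returns a value. -/
def rank : Loc V n → ℕ
  | .running m f _ => 6 * height m + phaseRank f
  | .done _ => 0

theorem rank_finish_lt {m : WithTop (Fin n)} {f : Phase} {v w : V} :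
    rank (G.finish m v) < rank (.running m f w) := by
  have hf : 0 < phaseRank f := by cases f <;> exact Nat.succ_pos _
  cases m with
  | top => exact Nat.add_pos_right _ hf
  | coe s =>
    have hheight := height_nextMatch_lt (G := G) (s := s)
    change 6 * height (G.nextMatch s) + 6 < 6 * height (s : WithTop (Fin n)) + phaseRank f
    omega

theorem rank_lt {p : Fin n} {ℓ : Loc V n} {o op k} (h : G.action p ℓ = .invoke o op k)
    (r : (kind V T o).Resp) : rank (k r) < rank ℓ := by
  have hphase : ∀ {m : WithTop (Fin n)} {f g : Phase} {v : V}, phaseRank f < phaseRank g →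
      rank (.running m f v) < rank (.running m g v) := fun h => Nat.add_lt_add_left h _
  cases ℓ with
  | done v => exact nomatch h
  | running m f v =>
    cases f with
    | write | apply | relook =>
      cases h
      exact hphase (by simp [phaseRank])
    | look =>
      cases h
      dsimp only
      split_ifs <;> exact hphase (by simp [phaseRank])
    | check =>
      cases h
      dsimp only
      cases Option.join r with
      | none => exact hphase (by simp [phaseRank])
      | some u => exact rank_finish_lt
    | fetch X =>
      cases h
      exact rank_finish_lt

end Rank

section Invariant

variable {V : Type u} {T : ObjType.{u}} {n : ℕ} (G : Tournament T (Fin n)) (input : Fin n → V)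

/-- The states of the matches of the tournament. -/
abbrev Matches (V : Type u) (T : ObjType.{u}) (n : ℕ) : Type u :=
  WithTop (Fin n) → MatchState V T (Fin n)

/-- The contents of the shared objects. -/
def shared (M : Matches V T n) : ∀ o : Cell n, (kind V T o).State
  | .obj m => (M m).obj
  | .reg m X => (M m).reg X

/-- The value `v` may be proposed by team `X` in match `m`, given the current outcomes. -/
abbrev ProposesIn (M : Matches V T n) (m : WithTop (Fin n)) (X : Bool) (v : V) : Prop :=
  G.Proposes input (fun m => (M m).outcome) m X v

/-- The invariant of the local state of process `p`. -/
def LocValid (M : Matches V T n) (p : Fin n) : Loc V n → Prop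
  | .running m f v => G.TakesPart m p ∧ G.ProposesIn input M m (G.team (G.role m p)) v ∧
      (M m).PhaseValid G.start G.team G.op (G.role m p) f
  | .done v => (M ⊤).outcome = some v

/-- The invariant of the tournament. -/
structure Invariant (M : Matches V T n) (loc : Fin n → Loc V n) : Prop where
  valid : ∀ m, (M m).Valid G.start G.team G.op
  proposed : ∀ {m X v}, (M m).reg X = some v → G.ProposesIn input M m X v
  locValid : ∀ p, G.LocValid input M p (loc p)

variable {G input} {M N : Matches V T n} {m : WithTop (Fin n)} {p : Fin n} {v : V}
  {M' : MatchState V T (Fin n)} {loc : Fin n → Loc V n} {ℓ : Loc V n}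

theorem locValid_finish (hm : G.TakesPart m p) (hv : (M m).outcome = some v) :
    G.LocValid input M p (G.finish m v) := by
  cases m with
  | top => exact hv
  | coe s => exact ⟨hm.next, hm.proposes_next hv, trivial⟩

theorem locValid_initLocal : G.LocValid input M p (.running p .write (input p)) :=
  ⟨takesPart_self, proposes_input, trivial⟩

theorem outcome_update_mono (hM' : ∀ {v}, (M m).outcome = some v → M'.outcome = some v)
    {m' : WithTop (Fin n)} {v : V} (h : (M m').outcome = some v) :
    (Function.update M m M' m').outcome = some v := by
  obtain rfl | hm := eq_or_ne m' m
  · rw [Function.update_self, hM' h]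
  · rwa [Function.update_of_ne hm]

theorem locValid_finish_update (hm : G.TakesPart m p) (hv : M'.outcome = some v) :
    G.LocValid input (Function.update M m M') p (G.finish m v) :=
  locValid_finish hm (by rwa [Function.update_self])

theorem locValid_running (hm : G.TakesPart m p)
    (hv : G.ProposesIn input M m (G.team (G.role m p)) v)
    (hM' : ∀ {v}, (M m).outcome = some v → M'.outcome = some v) {f : Phase}
    (hf : M'.PhaseValid G.start G.team G.op (G.role m p) f) :
    G.LocValid input (Function.update M m M') p (.running m f v) :=
  ⟨hm, hv.mono (outcome_update_mono hM'), by rwa [Function.update_self]⟩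

theorem Invariant.exists_eq_input (h : G.Invariant input M loc) (hv : (M m).outcome = some v) :
    ∃ p, v = input p :=
  Tournament.exists_eq_input (out := fun m => (M m).outcome)
    (fun h' => (MatchState.exists_reg_eq_of_outcome h').imp fun _ => h.proposed) hv

/-- A move of a player is harmless to everybody else since the roles in a match are distinct. -/
theorem Invariant.update (h : G.Invariant input M loc) (hm : G.TakesPart m p)
    (hmove : MatchState.IsMove G.start G.team G.op (G.role m p) (M m) M')
    (hreg : ∀ {X v}, M'.reg X = some v → G.ProposesIn input M m X v)
    (hℓ : G.LocValid input (Function.update M m M') p ℓ) :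
    G.Invariant input (Function.update M m M') (Function.update loc p ℓ) := by
  have hmono : ∀ {m' X v}, G.ProposesIn input M m' X v →
      G.ProposesIn input (Function.update M m M') m' X v := fun h' =>
    h'.mono (outcome_update_mono hmove.outcome_mono)
  refine ⟨fun m' => ?_, fun {m' X v} hv => hmono ?_, fun p' => ?_⟩
  · obtain rfl | hm' := eq_or_ne m' m
    · rw [Function.update_self]
      exact hmove.valid
    · rw [Function.update_of_ne hm']
      exact h.valid m'
  · obtain rfl | hm' := eq_or_ne m' m
    · rw [Function.update_self] at hv
      exact hreg hv
    · rw [Function.update_of_ne hm'] at hv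
      exact h.proposed hv
  · obtain rfl | hp' := eq_or_ne p' p
    · rwa [Function.update_self]
    rw [Function.update_of_ne hp']
    have hp := h.locValid p'
    cases hloc : loc p' with
    | done v =>
      rw [hloc] at hp
      exact outcome_update_mono hmove.outcome_mono hp
    | running m' f v =>
      rw [hloc] at hp
      refine ⟨hp.1, hmono hp.2.1, ?_⟩
      obtain rfl | hm' := eq_or_ne m' m
      · rw [Function.update_self]
        exact hmove.others (fun hrole => hp' (hp.1.role_inj hm hrole)) hp.2.2
      · rw [Function.update_of_ne hm']
        exact hp.2.2

open Classical in
theorem update_shared_obj (hreg : M'.reg = (M m).reg) :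
    Function.update (shared M) (.obj m) M'.obj = shared (Function.update M m M') := by
  refine Function.update_eq_iff.mpr ⟨by simp only [shared, Function.update_self], ?_⟩
  rintro (m' | ⟨m', X⟩) hne
  · simp only [shared, Function.update_of_ne fun h => hne (congrArg Cell.obj h)]
  · change (M m').reg X = (Function.update M m M' m').reg X
    obtain rfl | hm := eq_or_ne m' m
    · rw [Function.update_self, hreg]
    · rw [Function.update_of_ne hm]

open Classical in
theorem update_shared_reg {X : Bool} {a : Option V} (hobj : M'.obj = (M m).obj)
    (hreg : M'.reg = Function.update (M m).reg X a) :
    Function.update (shared M) (.reg m X) a = shared (Function.update M m M') := by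
  refine Function.update_eq_iff.mpr ⟨?_, ?_⟩
  · change a = (Function.update M m M' m).reg X
    rw [Function.update_self, hreg, Function.update_self]
  rintro (m' | ⟨m', Y⟩) hne
  · change (M m').obj = (Function.update M m M' m').obj
    obtain rfl | hm := eq_or_ne m' m
    · rw [Function.update_self, hobj]
    · rw [Function.update_of_ne hm]
  · change (M m').reg Y = (Function.update M m M' m').reg Y
    obtain rfl | hm := eq_or_ne m' m
    · have hY : Y ≠ X := fun h => hne (congrArg (Cell.reg m') h)
      rw [Function.update_self, hreg, Function.update_of_ne hY]
    · rw [Function.update_of_ne hm]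

open Classical in
theorem update_shared_read_obj (hobj : M'.obj = (M m).obj) (hreg : M'.reg = (M m).reg) :
    Function.update (shared M) (.obj m) (T.next (M m).obj G.read) =
      shared (Function.update M m M') := by
  rw [G.next_read, ← hobj]
  exact update_shared_obj hreg

open Classical in
theorem update_shared_read_reg {X : Bool} (hobj : M'.obj = (M m).obj)
    (hreg : M'.reg = (M m).reg) :
    Function.update (shared M) (.reg m X) ((M m).reg X) = shared (Function.update M m M') :=
  update_shared_reg hobj (hreg.trans (Function.update_eq_self X _).symm)

end Invariant

variable {V : Type u} {T : ObjType.{u}} {n : ℕ} {G : Tournament T (Fin n)} {input : Fin n → V}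
  {𝒯 : Set ObjType.{u}} {hT : T ∈ 𝒯 ∪ registers} {c : (G.algorithm V hT).Config}
  {M N : Matches V T n} {M' : MatchState V T (Fin n)} {m : WithTop (Fin n)} {p : Fin n} {v : V}

/-- The states `M` of the matches explain the configuration `c`. -/
structure Tracks (G : Tournament T (Fin n)) (input : Fin n → V) (M : Matches V T n)
    (c : (G.algorithm V hT).Config) : Prop where
  shared_eq : c.shared = shared M
  invariant : G.Invariant input M c.loc

/-- Each match that is decided in `M` has the same outcome in `N`. -/
def Extends (M N : Matches V T n) : Prop :=
  ∀ {m v}, (M m).outcome = some v → (N m).outcome = some v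

namespace Tracks

theorem initial : G.Tracks input (fun _ => .start G.start)
    ((G.algorithm V hT).initial input) where
  shared_eq := by
    funext o
    cases o <;> rfl
  invariant := ⟨fun _ => MatchState.valid_start, nofun, fun _ => locValid_initLocal⟩

theorem crash (h : G.Tracks input M c) :
    G.Tracks input M ((G.algorithm V hT).exec input c (.crash p)) := by
  refine ⟨h.shared_eq, h.invariant.valid, h.invariant.proposed, fun p' => ?_⟩
  obtain rfl | hp := eq_or_ne p' p
  · rw [Algorithm.exec_crash_loc_self]
    exact locValid_initLocal
  · rw [Algorithm.exec_crash_loc_of_ne hp]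
    exact h.invariant.locValid p'

theorem outcome_eq_some (h : G.Tracks input M c) (hact : G.action p (c.loc p) = .output v) :
    (M ⊤).outcome = some v := by
  have hp := h.invariant.locValid p
  rwa [eq_done_of_action_eq_output hact] at hp

open Classical in
theorem step_of_isMove (h : G.Tracks input M c) {o : Cell n} {op k}
    (hact : G.action p (c.loc p) = .invoke o op k)
    (hm : G.TakesPart m p)
    (hmove : MatchState.IsMove G.start G.team G.op (G.role m p) (M m) M')
    (hreg : ∀ {X v}, M'.reg X = some v → G.ProposesIn input M m X v)
    (hshared : Function.update (shared M) o ((kind V T o).next (shared M o) op) =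
      shared (Function.update M m M'))
    (hℓ : G.LocValid input (Function.update M m M') p (k ((kind V T o).resp (shared M o) op))) :
    ∃ N, Extends M N ∧ G.Tracks input N ((G.algorithm V hT).exec input c (.step p)) := by
  refine ⟨Function.update M m M', outcome_update_mono hmove.outcome_mono, ?_⟩
  rw [Algorithm.exec_step_of_invoke (A := G.algorithm V hT) hact, h.shared_eq]
  exact ⟨hshared, h.invariant.update hm hmove hreg hℓ⟩

theorem step_write (h : G.Tracks input M c) (hp : c.loc p = .running m .write v) :
    ∃ N, Extends M N ∧ G.Tracks input N ((G.algorithm V hT).exec input c (.step p)) := by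
  obtain ⟨hm, hv, -⟩ := hp ▸ h.invariant.locValid p
  have hmove := (h.invariant.valid m).isMove_announce (i := G.role m p) (X := G.team (G.role m p))
    fun hw => (h.invariant.proposed hw).unique hv
  refine h.step_of_isMove (congrArg (G.action p) hp) hm hmove ?_
    (update_shared_reg rfl rfl) (locValid_running hm hv hmove.outcome_mono ?_)
  · intro X w hw
    dsimp only at hw
    obtain rfl | hX := eq_or_ne X (G.team (G.role m p))
    · rw [Function.update_self] at hw
      exact Option.some.inj hw ▸ hv
    · rw [Function.update_of_ne hX] at hw
      exact h.invariant.proposed hw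
  · simp [MatchState.PhaseValid]

theorem step_look (h : G.Tracks input M c) (hp : c.loc p = .running m .look v) :
    ∃ N, Extends M N ∧ G.Tracks input N ((G.algorithm V hT).exec input c (.step p)) := by
  obtain ⟨hm, hv, hlook⟩ := hp ▸ h.invariant.locValid p
  have hvalid := h.invariant.valid m
  by_cases hobj : (M m).obj = G.start
  · have hmove := hvalid.isMove_reset (i := G.role m p) G.recording hobj
    refine h.step_of_isMove (congrArg (G.action p) hp) hm hmove
      h.invariant.proposed (update_shared_read_obj rfl rfl) ?_
    dsimp only [shared]
    rw [if_pos (by rw [hobj])]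
    split_ifs with hcheck
    · exact locValid_running hm hv hmove.outcome_mono
        (hvalid.phaseValid_check_reset G.recording hobj hlook hcheck)
    · exact locValid_running hm hv hmove.outcome_mono
        (hvalid.phaseValid_apply_reset G.recording hobj hlook hcheck)
  · refine h.step_of_isMove (congrArg (G.action p) hp) hm hvalid.isMove_self
      h.invariant.proposed (update_shared_read_obj rfl rfl) ?_
    dsimp only [shared]
    rw [if_neg (G.resp_read_injective.ne hobj), afterRead_resp]
    exact locValid_running hm hv id (hvalid.winner_eq G.recording (.inl hobj))

theorem step_check (h : G.Tracks input M c) (hp : c.loc p = .running m .check v) :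
    ∃ N, Extends M N ∧ G.Tracks input N ((G.algorithm V hT).exec input c (.step p)) := by
  obtain ⟨hm, hv, hcheck⟩ := hp ▸ h.invariant.locValid p
  have hvalid := h.invariant.valid m
  cases hreg : (M m).reg true with
  | none =>
    refine h.step_of_isMove (congrArg (G.action p) hp) hm hvalid.isMove_self
      h.invariant.proposed (update_shared_read_reg rfl rfl) ?_
    change G.LocValid input _ p (((M m).reg true).elim _ _)
    rw [hreg]
    exact locValid_running hm hv id (hvalid.phaseValid_apply_of_check hreg hcheck)
  | some w =>
    have hmove := hvalid.isMove_concede G.recording (by rw [hreg]; rfl) hcheck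
    refine h.step_of_isMove (congrArg (G.action p) hp) hm hmove
      h.invariant.proposed (update_shared_read_reg rfl rfl) ?_
    change G.LocValid input _ p (((M m).reg true).elim _ _)
    rw [hreg]
    exact locValid_finish_update hm (MatchState.outcome_eq_some rfl hreg)

theorem step_apply (h : G.Tracks input M c) (hp : c.loc p = .running m .apply v) :
    ∃ N, Extends M N ∧ G.Tracks input N ((G.algorithm V hT).exec input c (.step p)) := by
  obtain ⟨hm, hv, happly⟩ := hp ▸ h.invariant.locValid p
  have hmove := (h.invariant.valid m).isMove_accessBy G.recording happly
  exact h.step_of_isMove (congrArg (G.action p) hp) hm hmove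
    h.invariant.proposed (update_shared_obj (M' := .accessBy ..) rfl)
    (locValid_running hm hv hmove.outcome_mono nofun)

theorem step_relook (h : G.Tracks input M c) (hp : c.loc p = .running m .relook v) :
    ∃ N, Extends M N ∧ G.Tracks input N ((G.algorithm V hT).exec input c (.step p)) := by
  obtain ⟨hm, hv, hrelook⟩ := hp ▸ h.invariant.locValid p
  have hvalid := h.invariant.valid m
  refine h.step_of_isMove (congrArg (G.action p) hp) hm hvalid.isMove_self
    h.invariant.proposed (update_shared_read_obj rfl rfl) ?_
  change G.LocValid input _ p (G.afterRead m v (T.resp (M m).obj G.read))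
  rw [afterRead_resp]
  exact locValid_running hm hv id (hvalid.winner_eq G.recording (.inr hrelook))

theorem step_fetch (h : G.Tracks input M c) {X : Bool} (hp : c.loc p = .running m (.fetch X) v) :
    ∃ N, Extends M N ∧ G.Tracks input N ((G.algorithm V hT).exec input c (.step p)) := by
  obtain ⟨hm, -, hX⟩ := hp ▸ h.invariant.locValid p
  have hvalid := h.invariant.valid m
  obtain ⟨w, hw⟩ := Option.isSome_iff_exists.mp (hvalid.announced hX)
  refine h.step_of_isMove (congrArg (G.action p) hp) hm hvalid.isMove_self
    h.invariant.proposed (update_shared_read_reg rfl rfl) ?_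
  change G.LocValid input _ p (G.finish m (((M m).reg X).getD v))
  rw [hw]
  exact locValid_finish_update hm (MatchState.outcome_eq_some hX hw)

theorem exec (h : G.Tracks input M c) (e : Event n) :
    ∃ N, Extends M N ∧ G.Tracks input N ((G.algorithm V hT).exec input c e) := by
  cases e with
  | crash p => exact ⟨M, id, h.crash⟩
  | step p =>
    cases hp : c.loc p with
    | done v =>
      rw [Algorithm.exec_step_of_output (A := G.algorithm V hT) (congrArg (G.action p) hp)]
      exact ⟨M, id, h⟩
    | running m f v =>
      cases f with
      | write => exact h.step_write hp
      | look => exact h.step_look hp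
      | check => exact h.step_check hp
      | apply => exact h.step_apply hp
      | relook => exact h.step_relook hp
      | fetch X => exact h.step_fetch hp

end Tracks

theorem exists_tracks_config (σ : ℕ → Event n) (t : ℕ) :
    ∃ M, G.Tracks input M ((G.algorithm V hT).config input σ t) ∧
      ∀ s ≤ t, ∀ p v, (G.algorithm V hT).Outputs input σ s p v → (M ⊤).outcome = some v := by
  induction t with
  | zero =>
    have h₀ := Tracks.initial (G := G) (input := input) (hT := hT)
    refine ⟨_, h₀, fun s hs p v hv => ?_⟩
    obtain rfl := Nat.le_zero.mp hs
    exact h₀.outcome_eq_some hv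
  | succ t ih =>
    obtain ⟨M, hM, hout⟩ := ih
    obtain ⟨N, hMN, hN⟩ := hM.exec (σ t)
    refine ⟨N, hN, fun s hs p v hv => ?_⟩
    obtain hs | rfl := Nat.le_succ_iff.mp hs
    · exact hMN (hout s hs p v hv)
    · exact hN.outcome_eq_some hv

variable (G hT) in
theorem solvesRC_algorithm : (G.algorithm V hT).SolvesRC where
  agreement input σ s t p q v w hv hw := by
    obtain ⟨M, -, hout⟩ := G.exists_tracks_config (hT := hT) (input := input) σ (max s t)
    exact Option.some.inj ((hout s (le_max_left s t) p v hv).symm.trans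
      (hout t (le_max_right s t) q w hw))
  validity input σ t p v hv := by
    obtain ⟨M, hM, hout⟩ := G.exists_tracks_config (hT := hT) (input := input) σ t
    exact hM.invariant.exists_eq_input (hout t le_rfl p v hv)
  waitFree _ := Algorithm.exists_output_of_rank rank rank_lt

end Tournament

section ConsensusNumbers

variable {V : Type u} {𝒯 𝒯' : Set ObjType.{u}}

theorem ObjType.IsRecording.rcSolvable {T : ObjType.{u}} {ι : Type*} [Fintype ι] {q : T.State}
    {team : ι → Bool} {op : ι → T.Op} (hrec : T.IsRecording q team op) (hread : T.Readable)
    (hT : T ∈ 𝒯 ∪ registers) : RCSolvable V 𝒯 (Fintype.card ι) := by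
  have hrec' := hrec.comp_equiv (Fintype.equivFin ι).symm
  obtain ⟨read, hnext, hinj⟩ := hread
  choose captain hcaptain using hrec'.nonempty
  exact ⟨_, Tournament.solvesRC_algorithm
    { start := q
      team := _
      op := _
      recording := hrec'
      captain
      team_captain := hcaptain
      read
      next_read := hnext
      resp_read_injective := hinj } hT⟩

theorem readable_of_mem_registers {T : ObjType.{u}} (hT : T ∈ registers) : T.Readable := by
  obtain ⟨α, rfl⟩ := hT
  exact ⟨.read, fun _ => rfl, Option.some_injective α⟩

/-- The algorithm in which each process returns its own input without accessing any object. -/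
def Algorithm.outputInput (V : Type u) (𝒯 : Set ObjType.{u}) (n : ℕ) : Algorithm V 𝒯 n where
  Obj := PEmpty
  kind := PEmpty.elim
  kind_mem := nofun
  initShared := nofun
  Loc := V
  initLocal _ v := v
  action _ v := .output v

theorem Algorithm.outputInput_config_loc {n : ℕ} (input : Fin n → V) (σ : ℕ → Event n) (t : ℕ)
    (p : Fin n) : ((Algorithm.outputInput V 𝒯 n).config input σ t).loc p = input p := by
  induction t with
  | zero => rfl
  | succ t ih =>
    rw [Algorithm.config]
    cases σ t with
    | step q => exact ih
    | crash q =>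
      obtain rfl | hpq := eq_or_ne p q
      · exact Algorithm.exec_crash_loc_self
      · exact (Algorithm.exec_crash_loc_of_ne hpq).trans ih

theorem Algorithm.eq_input_of_outputInput_outputs {n : ℕ} {input : Fin n → V}
    {σ : ℕ → Event n} {t : ℕ} {p : Fin n} {v : V}
    (h : (Algorithm.outputInput V 𝒯 n).Outputs input σ t p v) : v = input p :=
  (NextAction.output.inj h).symm.trans (Algorithm.outputInput_config_loc input σ t p)

theorem rcSolvable_one : RCSolvable V 𝒯 1 :=
  ⟨Algorithm.outputInput V _ 1, {
    agreement _ _ _ _ p q _ _ hv hw := by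
      rw [Algorithm.eq_input_of_outputInput_outputs hv,
        Algorithm.eq_input_of_outputInput_outputs hw, Subsingleton.elim p q]
    validity _ _ _ p _ hv := ⟨p, Algorithm.eq_input_of_outputInput_outputs hv⟩
    waitFree _ _ _ t₀ _ _ := ⟨t₀, _, le_rfl, rfl⟩ }⟩

namespace Algorithm

variable {n : ℕ} (A : Algorithm V 𝒯 n) (h : 𝒯 ⊆ 𝒯')

/-- An algorithm with objects of types in `𝒯`, as an algorithm with objects of types in a larger
set `𝒯'`. -/
def ofSubset : Algorithm V 𝒯' n :=
  { A with kind_mem := fun o => h (A.kind_mem o) }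

/-- The same configuration, as one of `A.ofSubset h`. -/
def Config.ofSubset {A : Algorithm V 𝒯 n} (c : A.Config) : (A.ofSubset h).Config :=
  ⟨c.loc, c.shared⟩

variable {A} {input : Fin n → V}

theorem exec_ofSubset (c : A.Config) (e : Event n) :
    (A.ofSubset h).exec input (c.ofSubset h) e = (A.exec input c e).ofSubset h := by
  cases e with
  | crash p => rfl
  | step p =>
    cases hp : A.action p (c.loc p) with
    | output v => rw [exec_step_of_output hp, exec_step_of_output (c := c.ofSubset h) hp]
    | invoke o op k =>
      rw [exec_step_of_invoke hp, exec_step_of_invoke (c := c.ofSubset h) hp]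
      rfl

theorem config_ofSubset (σ : ℕ → Event n) (t : ℕ) :
    (A.ofSubset h).config input σ t = (A.config input σ t).ofSubset h := by
  induction t with
  | zero => rfl
  | succ t ih => rw [config, ih, exec_ofSubset, config]

theorem outputs_ofSubset : (A.ofSubset h).Outputs input = A.Outputs input := by
  funext σ t p v
  rw [Outputs, config_ofSubset]
  rfl

theorem SolvesRC.ofSubset (hA : A.SolvesRC) : (A.ofSubset h).SolvesRC where
  agreement input := outputs_ofSubset h ▸ hA.agreement input
  validity input := outputs_ofSubset h ▸ hA.validity input
  waitFree input := outputs_ofSubset h ▸ hA.waitFree input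

end Algorithm

theorem RCSolvable.mono (h : 𝒯 ⊆ 𝒯') {n : ℕ} : RCSolvable V 𝒯 n → RCSolvable V 𝒯' n :=
  fun ⟨_, hA⟩ => ⟨_, hA.ofSubset (Set.union_subset_union_left registers h)⟩

theorem RCSolvable.le_rcons {n : ℕ} (h : RCSolvable V 𝒯 n) : (n : ℕ∞) ≤ rcons V 𝒯 :=
  le_sSup ⟨n, rfl, h⟩

theorem rcons_mono (h : 𝒯 ⊆ 𝒯') : rcons V 𝒯 ≤ rcons V 𝒯' :=
  sSup_le fun _ ⟨_, hm, hn⟩ => hm ▸ (hn.mono h).le_rcons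

theorem exists_le_rcons_singleton [Nontrivial V] (h𝒯 : 𝒯.Nonempty)
    (hread : ∀ T ∈ 𝒯, T.Readable) {n : ℕ} (h : RCSolvable V 𝒯 (n + 1)) :
    ∃ T ∈ 𝒯, (n : ℕ∞) ≤ rcons V {T} := by
  obtain ⟨T₀, hT₀⟩ := h𝒯
  obtain hn | hn := le_or_gt n 1
  · exact ⟨T₀, hT₀, le_trans (mod_cast hn) (rcSolvable_one (V := V)).le_rcons⟩
  obtain ⟨A, hA⟩ := h
  obtain ⟨o, q, x, team, op, hrec⟩ := hA.exists_isRecording (by omega)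
  have hsolvable {𝒯' : Set ObjType} (hread' : (A.kind o).Readable)
      (ho : A.kind o ∈ 𝒯' ∪ registers) : RCSolvable V 𝒯' n := by
    simpa using hrec.rcSolvable hread' ho
  obtain ho | ho := A.kind_mem o
  · exact ⟨A.kind o, ho, (hsolvable (hread _ ho) (.inl (Set.mem_singleton _))).le_rcons⟩
  · exact ⟨T₀, hT₀, (hsolvable (readable_of_mem_registers ho) (.inr ho)).le_rcons⟩

theorem iSup_rcons_singleton_le : ⨆ T ∈ 𝒯, rcons V {T} ≤ rcons V 𝒯 :=
  iSup₂_le fun _ hT => rcons_mono (Set.singleton_subset_iff.mpr hT)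

theorem rcons_le_iSup_rcons_singleton_add_one [Nontrivial V] (h𝒯 : 𝒯.Nonempty)
    (hread : ∀ T ∈ 𝒯, T.Readable) : rcons V 𝒯 ≤ (⨆ T ∈ 𝒯, rcons V {T}) + 1 := by
  refine sSup_le ?_
  rintro _ ⟨k, rfl, hk⟩
  cases k with
  | zero => exact zero_le
  | succ n =>
    obtain ⟨T, hT, hn⟩ := exists_le_rcons_singleton h𝒯 hread hk
    exact_mod_cast add_le_add_left (hn.trans (le_iSup₂_of_le T hT le_rfl)) 1

end ConsensusNumbers

theorem theorem9 (V : Type u) [Nontrivial V] (𝒯 : Set ObjType.{u}) (h𝒯 : 𝒯.Nonempty)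
    (hread : ∀ T ∈ 𝒯, T.Readable) :
    (∀ n : ℕ∞, IsGreatest {m : ℕ∞ | ∃ T ∈ 𝒯, m = rcons V {T}} n →
      n ≤ rcons V 𝒯 ∧ rcons V 𝒯 ≤ n + 1) ∧
    ((¬ ∃ n : ℕ∞, IsGreatest {m : ℕ∞ | ∃ T ∈ 𝒯, m = rcons V {T}} n) → rcons V 𝒯 = ⊤) := by
  let S : Set ℕ∞ := {m | ∃ T ∈ 𝒯, m = rcons V {T}}
  have hS : sSup S = ⨆ T ∈ 𝒯, rcons V {T} := by
    rw [← sSup_image]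
    simp only [S, Set.image, eq_comm]
  have hle : sSup S ≤ rcons V 𝒯 := hS ▸ iSup_rcons_singleton_le
  refine ⟨fun n hn => ?_, fun hmax => top_unique (le_trans ?_ hle)⟩
  · rw [← hn.isLUB.sSup_eq]
    exact ⟨hle, hS ▸ rcons_le_iSup_rcons_singleton_add_one h𝒯 hread⟩
  · have : Nonempty S := h𝒯.elim fun T hT => ⟨_, T, hT, rfl⟩
    by_contra hlt
    exact hmax ⟨sSup S, ENat.sSup_mem_of_nonempty_of_lt_top (not_le.mp hlt), fun _ => le_sSup⟩
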